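/- A \emph{flat affine manifold} $(M,\nabla)$ of dimension $n\ge 0$ is a (Hausdorff, second countable) manifold with an atlas of \emph{flat charts} $(x^1,\dots,x^n)$ whose transition maps are locally affine transformations of $\mathbb R^n$ (equivalently, a manifold with a flat torsion-free connection $\nabla$). A smooth Riemannian metric $g$ on it is \emph{Hessian} if around every point there are flat coordinates and a smooth function $\varphi$ with $g_{ij}=\partial^2\varphi/\partial x^i\partial x^j$. On $\pi:TM\to M$, flat coordinates $x^i$ induce coordinates $(x^i,y^i)$; let $I$ be the endomorphism field of $T(TM)$ with $I\,\partial/\partial x^i=\partial/\partial y^i$, $I\,\partial/\partial y^i=-\partial/\partial x^i$, and put $g^{\mathrm r}(X,Y)=(\pi^*g)(X,Y)+(\pi^*g)(IX,IY)$. A \emph{developing map} is a map $\mathrm{dev}:M\to\mathbb R^n$ that near every point is a flat chart (a local affine diffeomorphism). \textbf{Theorem.} Let $(M,\nabla,g)$ be a simply connected Hessian manifold of dimension $n$, and let $G$ be the group of its affine isometries. (a) $I$ does not depend on the choice of the flat coordinates, and $(I,g^{\mathrm r})$ is a Kähler structure on $TM$. (b) A developing map exists. For every developing map $\mathrm{dev}$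 the map $TM\to M\times\mathbb R^n$, $(m,w)\mapsto (m,d(\mathrm{dev})_m w)$, is a diffeomorphism, and there is exactly one affine action $\theta$ of $G$ on $\mathbb R^n$ with $\mathrm{dev}(a(m))=\theta_a(\mathrm{dev}(m))$ for all $a\in G$, $m\in M$. (c) Let $G\ltimes_\theta\mathbb R^n$ be the semidirect product with multiplication $(a,u)(b,w)=(ab,\,u+A_a w)$, where $A_a$ is the linear part of $\theta_a$. Under the identification $TM=M\times\mathbb R^n$ of (b), the formula $$\psi_{(a,u)}(m,v)=(a(m),\ \theta_a(v)+u)$$ defines an action of $G\ltimes_\theta\mathbb R^n$ on $TM$ by smooth maps, and the Kähler structure $(I,g^{\mathrm r})$ is invariant under $\psi$: every $\psi_{(a,u)}$ commutes with $I$ and preserves $g^{\mathrm r}$. (d) In particular, if $(M,\nabla,g)$ is a homogeneous Hessian manifold for $G$ (that is, $G$ acts transitively on $M$), then $(TM,I,g^{\mathrm r})$ is a homogeneous Kähler manifold for $G\ltimes_\theta\mathbb R^n$ (that is, $G\ltimes_\theta\mathbb R^n$ acts transitively on $TM$ through $\psi$, preserving the Kähler structure). -/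

import Mathlib

open Set Filter Topology Bundle
open scoped Manifold ContDiff

noncomputable section

/-! ### Flat affine manifolds -/

/-- The standard vector space `ℝⁿ`. -/
abbrev Rn (n : ℕ) : Type := EuclideanSpace ℝ (Fin n)

/-- The pregroupoid of maps of `ℝⁿ` that agree near every point with an affine map. -/
def affinePregroupoid (n : ℕ) : Pregroupoid (Rn n) where
  property f s := ∀ x ∈ s, ∃ A : Rn n →ᵃ[ℝ] Rn n, f =ᶠ[𝓝 x] A
  comp := by
    intro f g u v hf hg _ _ _ x hx
    obtain ⟨A, hA⟩ := hf x hx.1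
    obtain ⟨B, hB⟩ := hg (f x) hx.2
    refine ⟨B.comp A, ?_⟩
    have hc : Tendsto f (𝓝 x) (𝓝 (f x)) := by
      have h1 : Tendsto A (𝓝 x) (𝓝 (A x)) :=
        (AffineMap.continuous_of_finiteDimensional A).continuousAt
      rw [← hA.eq_of_nhds] at h1
      exact h1.congr' hA.symm
    filter_upwards [hA, hc.eventually hB] with y hy1 hy2
    simp only [Function.comp_apply, AffineMap.coe_comp]
    rw [hy2, hy1]
  id_mem := fun x _ => ⟨AffineMap.id ℝ (Rn n), Filter.Eventually.of_forall fun _ => rfl⟩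
  locality := by
    intro f u _ h x hx
    obtain ⟨v, _, hxv, hf⟩ := h x hx
    exact hf x ⟨hx, hxv⟩
  congr := by
    intro f g u hu hfg hf x hx
    obtain ⟨A, hA⟩ := hf x hx
    refine ⟨A, ?_⟩
    filter_upwards [hA, hu.mem_nhds hx] with y hy1 hy2
    rw [hfg y hy2, hy1]

/-- The structure groupoid of local homeomorphisms of `ℝⁿ` that are, together with their
inverses, locally affine. A flat affine manifold is a space modelled on this groupoid: all the
transition maps between its charts are (locally) affine transformations. -/
def affineGroupoid (n : ℕ) : StructureGroupoid (Rn n) := (affinePregroupoid n).groupoid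

theorem affineGroupoid_le (n : ℕ) (k : WithTop ℕ∞) :
    affineGroupoid n ≤ contDiffGroupoid k 𝓘(ℝ, Rn n) := by
  refine groupoid_of_pregroupoid_le _ _ fun f s hf => ?_
  change ContDiffOn ℝ k _ _
  intro x hx
  obtain ⟨A, hA⟩ := hf x hx.1
  have h1 : ContDiffAt ℝ k A x := by
    have : ContDiff ℝ k (⟨A, AffineMap.continuous_of_finiteDimensional A⟩ : Rn n →ᴬ[ℝ] Rn n) :=
      ContinuousAffineMap.contDiff _
    exact this.contDiffAt
  exact (h1.congr_of_eventuallyEq hA).contDiffWithinAt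

section AffineManifold

variable (n : ℕ) (M : Type*) [TopologicalSpace M] [ChartedSpace (Rn n) M]
  [HasGroupoid M (affineGroupoid n)]

/-- A flat affine manifold is a smooth manifold. -/
instance affineManifold_isManifold (k : WithTop ℕ∞) : IsManifold 𝓘(ℝ, Rn n) k M :=
  { hasGroupoid_of_le ‹HasGroupoid M (affineGroupoid n)› (affineGroupoid_le n k) with }

/-- The flat charts of a flat affine manifold: their components are the systems of local
affine coordinates `x¹, …, xⁿ`. -/
def flatCharts : Set (OpenPartialHomeomorph M (Rn n)) := (affineGroupoid n).maximalAtlas M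

/-- The tangent bundle. -/
abbrev TanB : Type _ := TangentBundle 𝓘(ℝ, Rn n) M

end AffineManifold

section Constructions

variable {n : ℕ} {M : Type*} [TopologicalSpace M] [ChartedSpace (Rn n) M]
  [HasGroupoid M (affineGroupoid n)]

/-- Riemannian metrics on `M` (smooth). -/
abbrev RMetric (n : ℕ) (M : Type*) [TopologicalSpace M] [ChartedSpace (Rn n) M]
    [HasGroupoid M (affineGroupoid n)] : Type _ :=
  ContMDiffRiemannianMetric 𝓘(ℝ, Rn n) ∞ (Rn n) (TangentSpace 𝓘(ℝ, Rn n) : M → Type _)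

/-- A Riemannian metric on a flat affine manifold is Hessian if, in suitable flat coordinates
around every point, it is the Hessian `(∂²φ / ∂xⁱ∂xʲ)` of a smooth function `φ`. -/
def IsHessian (g : RMetric n M) : Prop :=
  ∀ x : M, ∃ e ∈ flatCharts n M, x ∈ e.source ∧ ∃ φ : Rn n → ℝ, ContDiffOn ℝ ∞ φ e.target ∧
    ∀ y ∈ e.source, ∀ v w : TangentSpace 𝓘(ℝ, Rn n) y,
      g.inner y v w = fderiv ℝ (fderiv ℝ φ) (e y)
        (mfderiv 𝓘(ℝ, Rn n) 𝓘(ℝ, Rn n) e y v) (mfderiv 𝓘(ℝ, Rn n) 𝓘(ℝ, Rn n) e y w)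

/-! ### The complex structure and the r-map metric on the tangent bundle -/

/-- The coordinates `(x¹, …, xⁿ, y¹, …, yⁿ)` on `π⁻¹(U) ⊆ TM` induced by a chart `e` of `M` on
`U`: the point `v ∈ T_m M` has the coordinates `(e(m), de_m(v))`. -/
def tangentCoord (e : OpenPartialHomeomorph M (Rn n)) (p : TanB n M) : Rn n × Rn n :=
  (e p.proj, mfderiv 𝓘(ℝ, Rn n) 𝓘(ℝ, Rn n) e p.proj p.2)

/-- The differential at `p ∈ TM` of the coordinates induced by the chart `e`. -/
def dTangentCoord (e : OpenPartialHomeomorph M (Rn n)) (p : TanB n M) :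
    TangentSpace 𝓘(ℝ, Rn n).tangent p →L[ℝ] Rn n × Rn n :=
  mfderiv 𝓘(ℝ, Rn n).tangent 𝓘(ℝ, Rn n × Rn n) (tangentCoord e) p

/-- The standard complex structure `∂/∂xⁱ ↦ ∂/∂yⁱ`, `∂/∂yⁱ ↦ -∂/∂xⁱ` of `ℝⁿ × ℝⁿ`. -/
def stdComplex (n : ℕ) : Rn n × Rn n →L[ℝ] Rn n × Rn n :=
  (-ContinuousLinearMap.snd ℝ (Rn n) (Rn n)).prod (ContinuousLinearMap.fst ℝ (Rn n) (Rn n))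

/-- The complex structure `I` of `TM`: at `p` it is the standard complex structure read in the
coordinates induced by the preferred flat chart at `π(p)`. -/
def affineComplex (n : ℕ) (M : Type*) [TopologicalSpace M] [ChartedSpace (Rn n) M]
    [HasGroupoid M (affineGroupoid n)] (p : TanB n M) :
    TangentSpace 𝓘(ℝ, Rn n).tangent p →L[ℝ] TangentSpace 𝓘(ℝ, Rn n).tangent p :=
  (dTangentCoord (chartAt (Rn n) p.proj) p).inverse ∘L stdComplex n ∘L
    dTangentCoord (chartAt (Rn n) p.proj) p

/-- The differential at `p` of the projection `π : TM → M`. -/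
def dProj (p : TanB n M) :
    TangentSpace 𝓘(ℝ, Rn n).tangent p →L[ℝ] TangentSpace 𝓘(ℝ, Rn n) p.proj :=
  mfderiv 𝓘(ℝ, Rn n).tangent 𝓘(ℝ, Rn n) (fun q : TanB n M => q.proj) p

/-- The r-map metric `gʳ(X, Y) = (π^* g)(X, Y) + (π^* g)(IX, IY)` on `TM`. -/
def rMetric (g : RMetric n M) (p : TanB n M) (X Y : TangentSpace 𝓘(ℝ, Rn n).tangent p) : ℝ :=
  g.inner p.proj (dProj p X) (dProj p Y) +
    g.inner p.proj (dProj p (affineComplex n M p X)) (dProj p (affineComplex n M p Y))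

end Constructions

/-! ### Kähler structures -/

section Kahler

variable {F : Type*} [NormedAddCommGroup F] [NormedSpace ℝ F] {H : Type*} [TopologicalSpace H]
  (I : ModelWithCorners ℝ F H) {N : Type*} [TopologicalSpace N] [ChartedSpace H N]

/-- The bilinear form `ω(X, Y) = h(JX, Y)`, read in the preferred chart of `N` at `p₀`. -/
def formInChart (J : ∀ p : N, TangentSpace I p →L[ℝ] TangentSpace I p)
    (h : ∀ p : N, TangentSpace I p → TangentSpace I p → ℝ) (p₀ : N) (y a b : F) : ℝ :=
  h ((extChartAt I p₀).symm y)
    (J ((extChartAt I p₀).symm y) (mfderiv 𝓘(ℝ, F) I (extChartAt I p₀).symm y a))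
    (mfderiv 𝓘(ℝ, F) I (extChartAt I p₀).symm y b)

/-- `(J, h)` is a Kähler structure on the manifold without boundary `N`. -/
structure IsKahler [IsManifold I ∞ N] [I.Boundaryless]
    (J : ∀ p : N, TangentSpace I p →L[ℝ] TangentSpace I p)
    (h : ∀ p : N, TangentSpace I p → TangentSpace I p → ℝ) : Prop where
  /-- `J` is a smooth field of endomorphisms -/
  smooth_J : ContMDiff I (I.prod 𝓘(ℝ, F →L[ℝ] F)) ∞
    (fun p : N => TotalSpace.mk' (F →L[ℝ] F)
      (E := fun p : N => TangentSpace I p →L[ℝ] TangentSpace I p) p (J p))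
  /-- `J` is an almost complex structure -/
  sq_J : ∀ (p : N) (X : TangentSpace I p), J p (J p X) = -X
  /-- `J` is integrable: there are holomorphic coordinates around every point -/
  integrable : ∀ p₀ : N, ∃ (k : ℕ) (Φ : OpenPartialHomeomorph N (EuclideanSpace ℂ (Fin k))),
    p₀ ∈ Φ.source ∧
    ContMDiffOn I 𝓘(ℝ, EuclideanSpace ℂ (Fin k)) ∞ Φ Φ.source ∧
    ContMDiffOn 𝓘(ℝ, EuclideanSpace ℂ (Fin k)) I ∞ Φ.symm Φ.target ∧
    ∀ p ∈ Φ.source, ∀ X : TangentSpace I p,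
      mfderiv I 𝓘(ℝ, EuclideanSpace ℂ (Fin k)) Φ p (J p X) =
        Complex.I • (show EuclideanSpace ℂ (Fin k) from
          mfderiv I 𝓘(ℝ, EuclideanSpace ℂ (Fin k)) Φ p X)
  /-- `h` is a smooth Riemannian metric -/
  riemannian : ∃ g : ContMDiffRiemannianMetric I ∞ F (TangentSpace I : N → Type _),
    ∀ (p : N) (X Y : TangentSpace I p), h p X Y = g.inner p X Y
  /-- `h` is Hermitian -/
  hermitian : ∀ (p : N) (X Y : TangentSpace I p), h p (J p X) (J p Y) = h p X Y
  /-- the Kähler form `ω(X, Y) = h(JX, Y)` is closed -/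
  closed : ∀ p₀ : N, ∀ y ∈ (extChartAt I p₀).target, ∀ a b c : F,
    fderiv ℝ (fun z => formInChart I J h p₀ z b c) y a
      - fderiv ℝ (fun z => formInChart I J h p₀ z a c) y b
      + fderiv ℝ (fun z => formInChart I J h p₀ z a b) y c = 0

/-- The structure `(J, h)` is invariant under the maps `ψ k`, `k ∈ K`: these are smooth, commute
with `J` and preserve `h`. -/
def IsInvariantUnder {K : Type*} (J : ∀ p : N, TangentSpace I p →L[ℝ] TangentSpace I p)
    (h : ∀ p : N, TangentSpace I p → TangentSpace I p → ℝ) (ψ : K → N → N) : Prop :=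
  ∀ k : K, ContMDiff I I ∞ (ψ k) ∧
    (∀ (p : N) (X : TangentSpace I p),
      mfderiv I I (ψ k) p (J p X) = J (ψ k p) (mfderiv I I (ψ k) p X)) ∧
    ∀ (p : N) (X Y : TangentSpace I p),
      h (ψ k p) (mfderiv I I (ψ k) p X) (mfderiv I I (ψ k) p Y) = h p X Y

/-- `ψ` is an action of the group `K`. -/
def IsGroupAction {K N : Type*} [Group K] (ψ : K → N → N) : Prop :=
  (∀ p, ψ 1 p = p) ∧ ∀ k l p, ψ (k * l) p = ψ k (ψ l p)

/-- `ψ` is transitive. -/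
def IsTransitive {K N : Type*} (ψ : K → N → N) : Prop := ∀ p q, ∃ k, ψ k p = q

/-- `(N, J, h)` is a homogeneous Kähler manifold for the group `K` acting by `ψ`. -/
def IsHomogeneousKahler [IsManifold I ∞ N] [I.Boundaryless] {K : Type*} [Group K]
    (J : ∀ p : N, TangentSpace I p →L[ℝ] TangentSpace I p)
    (h : ∀ p : N, TangentSpace I p → TangentSpace I p → ℝ) (ψ : K → N → N) : Prop :=
  IsKahler I J h ∧ IsGroupAction ψ ∧ IsInvariantUnder I J h ψ ∧ IsTransitive ψ

end Kahler

/-! ### Affine isometries, the developing map and the action on the tangent bundle -/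

section Action

variable {n : ℕ} {M : Type*} [TopologicalSpace M] [ChartedSpace (Rn n) M]

/-- `f` is an affine automorphism of `M`. -/
def IsAffineAut (f : M ≃ₜ M) : Prop :=
  ∃ s : Structomorph (affineGroupoid n) M M, s.toHomeomorph = f

theorem IsAffineAut.contMDiff {f : M ≃ₜ M} (hf : IsAffineAut (n := n) f) :
    ContMDiff 𝓘(ℝ, Rn n) 𝓘(ℝ, Rn n) ∞ f := by
  obtain ⟨s, rfl⟩ := hf
  intro x
  rw [contMDiffAt_iff]
  refine ⟨s.toHomeomorph.continuous.continuousAt, ?_⟩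
  have hs := (s.mem_groupoid _ _ (chart_mem_atlas (Rn n) x)
    (chart_mem_atlas (Rn n) (s.toHomeomorph x))).1 (chartAt (Rn n) x x) (by
      simp)
  obtain ⟨A, hA⟩ := hs
  have h1 : ContDiff ℝ ∞ A := by
    have : ContDiff ℝ ∞ (⟨A, AffineMap.continuous_of_finiteDimensional A⟩ : Rn n →ᴬ[ℝ] Rn n) :=
      ContinuousAffineMap.contDiff _
    exact this
  exact (h1.contDiffAt.congr_of_eventuallyEq hA).contDiffWithinAt

variable [HasGroupoid M (affineGroupoid n)]

/-- The group `G` of affine isometries of `(M, ∇, g)`. -/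
def affineIsometryGroup (g : RMetric n M) : Subgroup (M ≃ₜ M) where
  carrier := {f | IsAffineAut (n := n) f ∧ ∀ (x : M) (v w : TangentSpace 𝓘(ℝ, Rn n) x),
    g.inner (f x) (mfderiv 𝓘(ℝ, Rn n) 𝓘(ℝ, Rn n) f x v)
      (mfderiv 𝓘(ℝ, Rn n) 𝓘(ℝ, Rn n) f x w) = g.inner x v w}
  mul_mem' := by
    rintro a b ⟨ha, ha'⟩ ⟨hb, hb'⟩
    refine ⟨?_, fun x v w => ?_⟩
    · obtain ⟨s, rfl⟩ := ha
      obtain ⟨t, rfl⟩ := hb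
      exact ⟨t.trans s, rfl⟩
    · have h := mfderiv_comp (I := 𝓘(ℝ, Rn n)) (I' := 𝓘(ℝ, Rn n)) (I'' := 𝓘(ℝ, Rn n)) x
        ((ha.contMDiff (b x)).mdifferentiableAt (by simp))
        ((hb.contMDiff x).mdifferentiableAt (by simp))
      have e : (⇑(a * b) : M → M) = a ∘ b := rfl
      rw [e, h]
      exact (ha' (b x) _ _).trans (hb' x v w)
  one_mem' := by
    refine ⟨⟨Structomorph.refl M, rfl⟩, fun x v w => ?_⟩
    have e : (⇑(1 : M ≃ₜ M) : M → M) = id := rfl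
    rw [e, mfderiv_id]
    rfl
  inv_mem' := by
    rintro a ⟨ha, ha'⟩
    have hi : IsAffineAut (n := n) a⁻¹ := by
      obtain ⟨s, rfl⟩ := ha
      exact ⟨s.symm, rfl⟩
    refine ⟨hi, fun x v w => ?_⟩
    have h := mfderiv_comp (I := 𝓘(ℝ, Rn n)) (I' := 𝓘(ℝ, Rn n)) (I'' := 𝓘(ℝ, Rn n)) x
        ((ha.contMDiff (a⁻¹ x)).mdifferentiableAt (by simp))
        ((hi.contMDiff x).mdifferentiableAt (by simp))
    have e : (⇑a ∘ ⇑a⁻¹ : M → M) = id := by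
      funext y
      exact a.apply_symm_apply y
    have e' : a (a⁻¹ x) = x := a.apply_symm_apply x
    rw [e, mfderiv_id] at h
    rw [← ha' (a⁻¹ x)]
    have key : ∀ u : TangentSpace 𝓘(ℝ, Rn n) x,
        (mfderiv 𝓘(ℝ, Rn n) 𝓘(ℝ, Rn n) a (a⁻¹ x)
          (mfderiv 𝓘(ℝ, Rn n) 𝓘(ℝ, Rn n) (⇑a⁻¹) x u) : Rn n) = u := fun u =>
      (congrArg (fun L : Rn n →L[ℝ] Rn n => L u) h).symm
    have k2 : ∀ (y : M) (_ : y = x) (v' w' : Rn n),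
        g.inner y v' w' = g.inner x v' w' := by
      rintro y rfl v' w'
      rfl
    refine (k2 _ e' _ _).trans ?_
    exact congrArg₂ (fun (v' w' : Rn n) => g.inner x v' w') (key v) (key w)

/-- `(M, ∇, g)` is a homogeneous Hessian manifold for the group of its affine isometries. -/
def IsHomogeneousHessian (g : RMetric n M) : Prop :=
  IsHessian g ∧ IsTransitive fun (a : affineIsometryGroup g) (m : M) => (a : M ≃ₜ M) m

/-- `dev : M → ℝⁿ` is a developing map: a local affine diffeomorphism, that is, a map which near
every point is a flat chart. -/
def IsDevelopingMap (dev : M → Rn n) : Prop :=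
  ∀ x : M, ∃ e ∈ flatCharts n M, x ∈ e.source ∧ EqOn dev e e.source

/-- `dev` is equivariant for the action of `G` on `M` and the affine action `θ` of `G`
on `ℝⁿ`. -/
def IsDevEquivariant {g : RMetric n M} (dev : M → Rn n)
    (θ : affineIsometryGroup g →* (Rn n ≃ᵃ[ℝ] Rn n)) : Prop :=
  ∀ (a : affineIsometryGroup g) (m : M), dev ((a : M ≃ₜ M) m) = θ a (dev m)

/-- The action of a group on the translation group `ℝⁿ` through the linear part of an affine
action `θ`. -/
def linearAction {G : Type*} [Group G] (θ : G →* (Rn n ≃ᵃ[ℝ] Rn n)) :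
    G →* MulAut (Multiplicative (Rn n)) :=
  MonoidHom.mk' (fun a => AddEquiv.toMultiplicative (θ a).linear.toAddEquiv) (by
    intro a b
    refine MulEquiv.ext fun u => ?_
    rw [map_mul]
    rfl)

/-- The semidirect product `G ⋉_θ ℝⁿ`, with `(a, u) (b, w) = (a b, u + A_a w)` where `A_a` is the
linear part of `θ_a`. -/
abbrev AffSemidirect {G : Type*} [Group G] (θ : G →* (Rn n ≃ᵃ[ℝ] Rn n)) : Type _ :=
  Multiplicative (Rn n) ⋊[linearAction θ] G

/-- The trivialization `TM ≃ M × ℝⁿ` given by the flat structure: `v ∈ T_m M` is mapped to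
`(m, d(dev)_m(v))`. -/
def flatTriv (dev : M → Rn n) (p : TanB n M) : M × Rn n :=
  (p.proj, mfderiv 𝓘(ℝ, Rn n) 𝓘(ℝ, Rn n) dev p.proj p.2)

/-- The action `ψ` of `G ⋉_θ ℝⁿ` on `TM`: in the trivialization `TM ≃ M × ℝⁿ` the element `(a, u)`
maps `(m, v)` to `(a(m), θ_a(v) + u)`. -/
def psi {g : RMetric n M} (dev : M → Rn n)
    (θ : affineIsometryGroup g →* (Rn n ≃ᵃ[ℝ] Rn n)) (k : AffSemidirect θ) (p : TanB n M) :
    TanB n M :=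
  ⟨(k.right : M ≃ₜ M) p.proj,
    (mfderiv 𝓘(ℝ, Rn n) 𝓘(ℝ, Rn n) dev ((k.right : M ≃ₜ M) p.proj)).inverse
      (θ k.right (flatTriv dev p).2 + Multiplicative.toAdd k.left)⟩

end Action

end

noncomputable section

/-! ### Locally affine maps -/

/-! Everything about `dev` and `θ` rests on the rigidity of affine germs: an affine map of `ℝⁿ` is
determined by its values on a nonempty open set. Hence two flat germs at `x` (`IsFlatAt`) differ by
a unique affine equivalence, which is locally constant in `x`. The germs of developing maps
therefore form a covering of `M` whose fibre is the discrete affine group, and simple connectedness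
gives a global section, that is, a developing map (`exists_isDevelopingMap`). For an affine isometry
`a` the map `dev ∘ a` has flat germs again, so connectedness gives `dev ∘ a = θ_a ∘ dev`; uniqueness
of `θ_a` makes `θ` a homomorphism.

On `TM` a flat map `f` induces the coordinates `(f, df)`. An affine change `A` of `f` acts on them
by `(A, A.linear)`, whose derivative consists of two equal diagonal blocks and so commutes with `(x,
y) ↦ (-y, x)`. This gives `dFlatCoord_affineComplex`: `I` is standard in all flat coordinates, and
the functions `x + iy` are holomorphic coordinates. Read in `(dev, d dev)`, the action `ψ` also has
a derivative with two equal blocks, so it preserves `I`. It covers the isometry `a`, so it preserves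
`gʳ`, which is built from `g`, `dπ` and `I` alone. Translations are transitive on the fibres, so
transitivity on `M` lifts to `TM`.

In flat coordinates `gʳ` is `g ⊕ g`, and its Kähler form is `ω(b, c) = g(b₁, c₂) - g(b₂, c₁)` with
coefficients depending on `x` only. Closedness follows from the total symmetry of `∂ₖ gᵢⱼ`, which
for `g = ∂²φ` is the symmetry of third derivatives (`third_fderiv_symm`). This is the only point
where the Hessian condition enters. -/

theorem AffineMap.eq_of_eventuallyEq {n : ℕ} {A B : Rn n →ᵃ[ℝ] Rn n} {x : Rn n}
    (h : (A : Rn n → Rn n) =ᶠ[𝓝 x] B) : A = B := by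
  obtain ⟨u, hu, huo, hxu⟩ := eventually_nhds_iff.1 h
  exact AffineMap.ext_on (huo.affineSpan_eq_top ⟨x, hxu⟩) fun y hy => hu y hy

theorem AffineEquiv.eq_of_eventuallyEq {n : ℕ} {A B : Rn n ≃ᵃ[ℝ] Rn n} {x : Rn n}
    (h : (A : Rn n → Rn n) =ᶠ[𝓝 x] B) : A = B :=
  AffineEquiv.toAffineMap_injective (AffineMap.eq_of_eventuallyEq (x := x) h)

theorem AffineEquiv.contDiff_of_finiteDimensional {n : ℕ} (A : Rn n ≃ᵃ[ℝ] Rn n)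
    {k : WithTop ℕ∞} : ContDiff ℝ k A := by
  have : ContDiff ℝ k (⟨A.toAffineMap, AffineMap.continuous_of_finiteDimensional A.toAffineMap⟩ :
      Rn n →ᴬ[ℝ] Rn n) := ContinuousAffineMap.contDiff _
  exact this

/-- The linear part of an affine equivalence of `ℝⁿ`, as a continuous linear equivalence. -/
def AffineEquiv.linearCLE {n : ℕ} (A : Rn n ≃ᵃ[ℝ] Rn n) : Rn n ≃L[ℝ] Rn n :=
  A.linear.toContinuousLinearEquiv

@[simp]
theorem AffineEquiv.linearCLE_apply {n : ℕ} (A : Rn n ≃ᵃ[ℝ] Rn n) (v : Rn n) :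
    A.linearCLE v = A.linear v := rfl

theorem AffineEquiv.hasFDerivAt {n : ℕ} (A : Rn n ≃ᵃ[ℝ] Rn n) (x : Rn n) :
    HasFDerivAt A (A.linearCLE : Rn n →L[ℝ] Rn n) x := by
  have h : (A : Rn n → Rn n) = fun y => A.linearCLE y + A 0 := by
    funext y
    simpa using A.map_vadd 0 y
  rw [h]
  exact A.linearCLE.hasFDerivAt.add_const _

/-! ### Germs of flat coordinates on a manifold. -/

section Flat

variable {n : ℕ} {M : Type*} [TopologicalSpace M]

/-- Two germs of maps to `ℝⁿ` differ by an invertible affine map. -/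
def AffineRelatedAt (f f' : M → Rn n) (x : M) : Prop :=
  ∃ A : Rn n ≃ᵃ[ℝ] Rn n, f' =ᶠ[𝓝 x] A ∘ f

theorem AffineRelatedAt.symm {f f' : M → Rn n} {x : M} (h : AffineRelatedAt f f' x) :
    AffineRelatedAt f' f x := by
  obtain ⟨A, hA⟩ := h
  refine ⟨A.symm, ?_⟩
  filter_upwards [hA] with y hy
  simp [hy]

theorem AffineRelatedAt.trans {f f' f'' : M → Rn n} {x : M} (h : AffineRelatedAt f f' x)
    (h' : AffineRelatedAt f' f'' x) : AffineRelatedAt f f'' x := by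
  obtain ⟨A, hA⟩ := h
  obtain ⟨B, hB⟩ := h'
  refine ⟨A.trans B, ?_⟩
  filter_upwards [hA, hB] with y hy hy'
  simp [hy, hy']

theorem AffineRelatedAt.eventually {f f' : M → Rn n} {x : M} (h : AffineRelatedAt f f' x) :
    ∀ᶠ y in 𝓝 x, AffineRelatedAt f f' y := by
  obtain ⟨A, hA⟩ := h
  exact hA.eventually_nhds.mono fun y hy => ⟨A, hy⟩

/-- If the transition map between two charts and its inverse are locally affine, the charts are
affinely related. -/
theorem affineRelatedAt_of_locally_affine {e e' : OpenPartialHomeomorph M (Rn n)} {x : M}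
    (hx : x ∈ e.source) (hx' : x ∈ e'.source)
    (h : ∃ A : Rn n →ᵃ[ℝ] Rn n, (e' ∘ e.symm) =ᶠ[𝓝 (e x)] A)
    (h' : ∃ A : Rn n →ᵃ[ℝ] Rn n, (e ∘ e'.symm) =ᶠ[𝓝 (e' x)] A) :
    AffineRelatedAt e e' x := by
  have key : ∀ {e e' : OpenPartialHomeomorph M (Rn n)} {A : Rn n →ᵃ[ℝ] Rn n},
      x ∈ e.source → (e' ∘ e.symm) =ᶠ[𝓝 (e x)] A → e' =ᶠ[𝓝 x] A ∘ e := by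
    intro e e' A hx hA
    filter_upwards [(e.continuousAt hx).eventually hA, e.eventually_left_inverse hx] with y h1 h2
    rw [Function.comp_apply, ← h1, Function.comp_apply, h2]
  -- The two affine maps are inverse to each other near one point only; rigidity of affine germs
  -- makes them inverse everywhere.
  have key2 : ∀ {e e' : OpenPartialHomeomorph M (Rn n)} {A B : Rn n →ᵃ[ℝ] Rn n},
      x ∈ e.source → (e' ∘ e.symm) =ᶠ[𝓝 (e x)] A → e =ᶠ[𝓝 x] B ∘ e' →
      B.comp A = AffineMap.id ℝ (Rn n) := by
    intro e e' A B hx hA hB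
    refine AffineMap.eq_of_eventuallyEq (x := e x) ?_
    have ht : Tendsto e.symm (𝓝 (e x)) (𝓝 x) := by
      simpa [e.left_inv hx] using (e.continuousAt_symm (e.map_source hx)).tendsto
    filter_upwards [hA, ht.eventually hB, e.eventually_right_inverse (e.map_source hx)]
      with y h1 h2 h3
    rw [AffineMap.comp_apply, ← h1, AffineMap.id_apply]
    exact h2.symm.trans h3
  obtain ⟨A, hA⟩ := h
  obtain ⟨B, hB⟩ := h'
  have hAB := key2 hx hA (key hx' hB)
  have hBA := key2 hx' hB (key hx hA)
  refine ⟨{ toFun := A, invFun := B, left_inv := fun y => ?_, right_inv := fun y => ?_,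
            linear := LinearEquiv.ofLinearMap A.linear B.linear ?_ ?_,
            map_vadd' := fun p v => A.map_vadd p v }, key hx hA⟩
  · exact congrArg (fun f : Rn n →ᵃ[ℝ] Rn n => f y) hAB
  · exact congrArg (fun f : Rn n →ᵃ[ℝ] Rn n => f y) hBA
  · exact congrArg AffineMap.linear hBA
  · exact congrArg AffineMap.linear hAB

theorem affineRelatedAt_of_mem_affineGroupoid {e e' : OpenPartialHomeomorph M (Rn n)} {x : M}
    (hx : x ∈ e.source) (hx' : x ∈ e'.source) (h : e.symm ≫ₕ e' ∈ affineGroupoid n) :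
    AffineRelatedAt e e' x := by
  obtain ⟨h1, h2⟩ := mem_groupoid_of_pregroupoid.1 h
  refine affineRelatedAt_of_locally_affine hx hx' (h1 (e x) ?_) (h2 (e' x) ?_)
  · simp [hx, hx']
  · simp [hx, hx']

variable [ChartedSpace (Rn n) M]

/-- `f` is near `x` an affine change of the preferred chart at `x`. -/
def IsFlatAt (f : M → Rn n) (x : M) : Prop := AffineRelatedAt (chartAt (Rn n) x) f x

theorem IsFlatAt.affineRelatedAt {f f' : M → Rn n} {x : M} (h : IsFlatAt f x)
    (h' : IsFlatAt f' x) : AffineRelatedAt f f' x := h.symm.trans h'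

/-- Flat germs are open at their base point. -/
theorem IsFlatAt.map_nhds {f : M → Rn n} {x : M} (h : IsFlatAt f x) : 𝓝 (f x) = map f (𝓝 x) := by
  obtain ⟨A, hA⟩ := h
  rw [Filter.map_congr hA, ← Filter.map_map, (chartAt (Rn n) x).map_nhds_eq (mem_chart_source _ x),
    hA.eq_of_nhds]
  exact (A.toContinuousAffineEquiv.toHomeomorph.map_nhds_eq _).symm

/-- The affine map relating two flat germs is unique. -/
theorem IsFlatAt.affineEquiv_unique {f : M → Rn n} {x : M} (h : IsFlatAt f x)
    {A B : Rn n ≃ᵃ[ℝ] Rn n} (hAB : A ∘ f =ᶠ[𝓝 x] B ∘ f) : A = B := by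
  refine AffineEquiv.eq_of_eventuallyEq (x := f x) ?_
  rw [h.map_nhds]
  exact hAB

theorem flatCharts_subset_maximalAtlas {e : OpenPartialHomeomorph M (Rn n)}
    (he : e ∈ flatCharts n M) (k : WithTop ℕ∞) :
    e ∈ IsManifold.maximalAtlas 𝓘(ℝ, Rn n) k M :=
  (mem_maximalAtlas_iff (G := contDiffGroupoid k 𝓘(ℝ, Rn n))).2 fun e' he' =>
    have h := (mem_maximalAtlas_iff (G := affineGroupoid n)).1 he e' he'
    ⟨affineGroupoid_le n k h.1, affineGroupoid_le n k h.2⟩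

theorem flatCharts_affineRelatedAt {e e' : OpenPartialHomeomorph M (Rn n)}
    (he : e ∈ flatCharts n M) (he' : e' ∈ flatCharts n M) {x : M} (hx : x ∈ e.source)
    (hx' : x ∈ e'.source) : AffineRelatedAt e e' x :=
  affineRelatedAt_of_mem_affineGroupoid hx hx'
    ((affineGroupoid n).compatible_of_mem_maximalAtlas he he')

variable [HasGroupoid M (affineGroupoid n)]

theorem chartAt_mem_flatCharts (x : M) : chartAt (Rn n) x ∈ flatCharts n M :=
  (affineGroupoid n).chart_mem_maximalAtlas x

theorem flatCharts_isFlatAt {e : OpenPartialHomeomorph M (Rn n)}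
    (he : e ∈ flatCharts n M) {x : M} (hx : x ∈ e.source) : IsFlatAt e x :=
  flatCharts_affineRelatedAt (chartAt_mem_flatCharts x) he (mem_chart_source _ x) hx

theorem mem_flatCharts_of_isFlatAt {e : OpenPartialHomeomorph M (Rn n)}
    (h : ∀ x ∈ e.source, IsFlatAt e x) : e ∈ flatCharts n M := by
  have key : ∀ {e e' : OpenPartialHomeomorph M (Rn n)},
      (∀ x ∈ e.source, x ∈ e'.source → AffineRelatedAt e e' x) →
      (affinePregroupoid n).property (e.symm ≫ₕ e') (e.symm ≫ₕ e').source := by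
    intro e e' h y hy
    obtain ⟨hy1, hy2⟩ : y ∈ e.target ∧ e.symm y ∈ e'.source := by simpa using hy
    obtain ⟨A, hA⟩ := h (e.symm y) (e.map_target hy1) hy2
    refine ⟨A.toAffineMap, ?_⟩
    filter_upwards [(e.continuousAt_symm hy1).eventually hA, e.eventually_right_inverse hy1]
      with z h1 h2
    simp only [OpenPartialHomeomorph.coe_trans, Function.comp_apply, h1, h2,
      AffineEquiv.coe_toAffineMap]
  have hE : ∀ e' ∈ atlas (Rn n) M, e.symm ≫ₕ e' ∈ affineGroupoid n := by
    intro e' he'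
    have hrel : ∀ x ∈ e.source, x ∈ e'.source → AffineRelatedAt e e' x := fun x hx hx' =>
      (h x hx).affineRelatedAt
        (flatCharts_isFlatAt ((affineGroupoid n).subset_maximalAtlas he') hx')
    refine mem_groupoid_of_pregroupoid.2 ⟨key hrel, ?_⟩
    exact key (e := e') (e' := e) fun x hx hx' => (hrel x hx' hx).symm
  refine (mem_maximalAtlas_iff (G := affineGroupoid n)).2 fun e' he' => ⟨hE e' he', ?_⟩
  exact (affineGroupoid n).symm (hE e' he')

/-- This replaces charts by germs: an affine change of the preferred chart, restricted to the open
set where it agrees with `f`, is itself a flat chart. -/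
theorem isDevelopingMap_iff {f : M → Rn n} : IsDevelopingMap f ↔ ∀ x, IsFlatAt f x := by
  refine ⟨fun h x => ?_, fun h x => ?_⟩
  · obtain ⟨e, he, hx, hf⟩ := h x
    obtain ⟨A, hA⟩ := flatCharts_isFlatAt he hx
    exact ⟨A, (hf.eventuallyEq_of_mem (e.open_source.mem_nhds hx)).trans hA⟩
  · obtain ⟨A, hA⟩ := h x
    obtain ⟨u, hu, huo, hxu⟩ := eventually_nhds_iff.1 hA
    let e : OpenPartialHomeomorph M (Rn n) := ((chartAt (Rn n) x).restrOpen u huo).transHomeomorph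
      (A.toContinuousAffineEquiv).toHomeomorph
    have hes : e.source = (chartAt (Rn n) x).source ∩ u := rfl
    have hef : EqOn f e e.source := fun y hy => hu y hy.2
    refine ⟨e, mem_flatCharts_of_isFlatAt fun y hy => ?_, ⟨mem_chart_source _ x, hxu⟩, hef⟩
    refine (flatCharts_isFlatAt (chartAt_mem_flatCharts x) hy.1).trans ⟨A, ?_⟩
    exact Eventually.of_forall fun z => rfl

theorem IsFlatAt.contMDiffAt {f : M → Rn n} {x : M} (h : IsFlatAt f x) {k : WithTop ℕ∞} :
    ContMDiffAt 𝓘(ℝ, Rn n) 𝓘(ℝ, Rn n) k f x := by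
  obtain ⟨A, hA⟩ := h
  refine ContMDiffAt.congr_of_eventuallyEq ?_ hA
  refine ContMDiffAt.comp x A.contDiff_of_finiteDimensional.contMDiff.contMDiffAt ?_
  exact contMDiffAt_of_mem_maximalAtlas
    (flatCharts_subset_maximalAtlas (chartAt_mem_flatCharts x) k) (mem_chart_source _ x)

theorem IsFlatAt.mdifferentiableAt {f : M → Rn n} {x : M} (h : IsFlatAt f x) :
    MDifferentiableAt 𝓘(ℝ, Rn n) 𝓘(ℝ, Rn n) f x :=
  (h.contMDiffAt (k := 1)).mdifferentiableAt one_ne_zero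

theorem IsFlatAt.eventually {f : M → Rn n} {x : M} (h : IsFlatAt f x) :
    ∀ᶠ y in 𝓝 x, IsFlatAt f y := by
  filter_upwards [AffineRelatedAt.eventually h,
    (chartAt (Rn n) x).open_source.mem_nhds (mem_chart_source _ x)] with y hy hy'
  exact (flatCharts_isFlatAt (chartAt_mem_flatCharts x) hy').trans hy

theorem IsFlatAt.mfderiv_of_eventuallyEq {f f' : M → Rn n} {x : M} (h : IsFlatAt f x)
    {A : Rn n ≃ᵃ[ℝ] Rn n} (hA : f' =ᶠ[𝓝 x] A ∘ f) (v : TangentSpace 𝓘(ℝ, Rn n) x) :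
    mfderiv 𝓘(ℝ, Rn n) 𝓘(ℝ, Rn n) f' x v =
      A.linear (mfderiv 𝓘(ℝ, Rn n) 𝓘(ℝ, Rn n) f x v) := by
  rw [hA.mfderiv_eq, mfderiv_comp x (A.hasFDerivAt (f x)).hasMFDerivAt.mdifferentiableAt
    h.mdifferentiableAt, (A.hasFDerivAt (f x)).hasMFDerivAt.mfderiv]
  rfl

theorem IsFlatAt.mfderiv_isInvertible {f : M → Rn n} {x : M} (h : IsFlatAt f x) :
    (mfderiv 𝓘(ℝ, Rn n) 𝓘(ℝ, Rn n) f x).IsInvertible := by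
  obtain ⟨A, hA⟩ := h
  have h1 : IsFlatAt (chartAt (Rn n) x) x :=
    flatCharts_isFlatAt (chartAt_mem_flatCharts x) (mem_chart_source _ x)
  have h2 : (mfderiv 𝓘(ℝ, Rn n) 𝓘(ℝ, Rn n) (chartAt (Rn n) x) x).IsInvertible :=
    isInvertible_mfderiv_extChartAt (I := 𝓘(ℝ, Rn n)) (mem_extChartAt_source x)
  obtain ⟨L, hL⟩ := h2
  refine ⟨L.trans A.linearCLE, ?_⟩
  ext1 v
  rw [h1.mfderiv_of_eventuallyEq hA, ← hL]
  rfl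

end Flat

/-! ### Existence of developing maps -/

section Development

/-- The affine group of `ℝⁿ`, with the discrete topology. -/
def DiscreteAffine (n : ℕ) : Type := Rn n ≃ᵃ[ℝ] Rn n

instance (n : ℕ) : TopologicalSpace (DiscreteAffine n) := ⊥

instance (n : ℕ) : DiscreteTopology (DiscreteAffine n) := ⟨rfl⟩

variable {n : ℕ} {M : Type*} [TopologicalSpace M] [ChartedSpace (Rn n) M]
  [HasGroupoid M (affineGroupoid n)]

theorem atlas_affineRelatedAt (i j : atlas (Rn n) M) {x : M} (hi : x ∈ i.1.source)
    (hj : x ∈ j.1.source) : AffineRelatedAt i.1 j.1 x :=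
  flatCharts_affineRelatedAt ((affineGroupoid n).subset_maximalAtlas i.2)
    ((affineGroupoid n).subset_maximalAtlas j.2) hi hj

open Classical in
/-- The affine transition map at `x` from the chart `i` to the chart `j`. -/
def affineTransition (i j : atlas (Rn n) M) (x : M) : Rn n ≃ᵃ[ℝ] Rn n :=
  if h : AffineRelatedAt i.1 j.1 x then h.choose else AffineEquiv.refl ℝ (Rn n)

theorem affineTransition_spec (i j : atlas (Rn n) M) {x : M} (hi : x ∈ i.1.source)
    (hj : x ∈ j.1.source) : j.1 =ᶠ[𝓝 x] affineTransition i j x ∘ i.1 := by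
  have h := atlas_affineRelatedAt i j hi hj
  rw [affineTransition, dif_pos h]
  exact h.choose_spec

theorem atlas_isFlatAt (i : atlas (Rn n) M) {x : M} (hi : x ∈ i.1.source) : IsFlatAt i.1 x :=
  flatCharts_isFlatAt ((affineGroupoid n).subset_maximalAtlas i.2) hi

theorem affineTransition_eq {i j : atlas (Rn n) M} {x : M} (hi : x ∈ i.1.source)
    (hj : x ∈ j.1.source) {A : Rn n ≃ᵃ[ℝ] Rn n} (hA : j.1 =ᶠ[𝓝 x] A ∘ i.1) :
    affineTransition i j x = A :=
  (atlas_isFlatAt i hi).affineEquiv_unique ((affineTransition_spec i j hi hj).symm.trans hA)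

variable (n M) in
/-- The bundle of germs of developing maps: the element `A` of the fibre at `x`, in the
trivialization given by the chart `i`, stands for the germ at `x` of `A ∘ i`. -/
def flatGermCore : FiberBundleCore (atlas (Rn n) M) M (DiscreteAffine n) where
  baseSet i := i.1.source
  isOpen_baseSet i := i.1.open_source
  indexAt := achart (Rn n)
  mem_baseSet_at := mem_chart_source (Rn n)
  -- The direction is reversed: the germ `A ∘ i` equals `A ∘ (transition from j to i) ∘ j`, so the
  -- transition is applied before `A`.
  coordChange i j x A := (affineTransition j i x).trans A
  coordChange_self i x hx A := by
    rw [affineTransition_eq hx hx (A := AffineEquiv.refl ℝ (Rn n)) (by rfl)]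
    exact AffineEquiv.refl_trans A
  continuousOn_coordChange i j := by
    rintro ⟨x, A⟩ ⟨⟨hi, hj⟩, -⟩
    refine ContinuousAt.continuousWithinAt ?_
    refine (continuousAt_const (y := (show DiscreteAffine n from (affineTransition j i x).trans A))).congr ?_
    -- The affine map that works at `x` also works at nearby points, where uniqueness identifies it
    -- with the chosen transition.
    have h1 : ∀ᶠ y in 𝓝 x, affineTransition j i y = affineTransition j i x := by
      filter_upwards [(affineTransition_spec j i hj hi).eventually_nhds,
        i.1.open_source.mem_nhds hi, j.1.open_source.mem_nhds hj] with y hy hyi hyj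
      exact affineTransition_eq hyj hyi hy
    have h2 : ∀ᶠ B : DiscreteAffine n in 𝓝 A, B = A := by
      rw [nhds_discrete (DiscreteAffine n)]
      exact rfl
    rw [nhds_prod_eq]
    filter_upwards [h1.prod_mk h2] with p hp
    exact congrArg₂ AffineEquiv.trans hp.1.symm hp.2.symm
  coordChange_comp i j k x hx A := by
    obtain ⟨⟨hi, hj⟩, hk⟩ := hx
    have : affineTransition k i x = (affineTransition k j x).trans (affineTransition j i x) := by
      refine affineTransition_eq hk hi ?_
      filter_upwards [affineTransition_spec k j hk hj, affineTransition_spec j i hj hi]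
        with y h1 h2
      simp [h1, h2]
    rw [this]
    exact AffineEquiv.trans_assoc _ _ _

/-- A simply connected flat affine manifold has a developing map. -/
theorem exists_isDevelopingMap [SimplyConnectedSpace M] :
    ∃ dev : M → Rn n, IsDevelopingMap dev := by
  have : LocallyPathConnectedSpace M := ChartedSpace.locallyPathConnectedSpace (Rn n) M
  let Z := flatGermCore n M
  obtain ⟨x₀⟩ : Nonempty M := inferInstance
  -- A fibre bundle with discrete fibre is a covering. Lifting the identity of `M` through it yields
  -- a continuous section.
  have hcov : IsCoveringMap Z.proj := FiberBundle.isCoveringMap (F := DiscreteAffine n)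
    (E := Z.Fiber)
  obtain ⟨F, ⟨-, hF⟩, -⟩ := hcov.existsUnique_continuousMap_lifts (ContinuousMap.id M) x₀
    (⟨x₀, AffineEquiv.refl ℝ (Rn n)⟩ : Z.TotalSpace) rfl
  have hproj : ∀ x, (F x).proj = x := fun x => congrFun hF x
  let a : M → DiscreteAffine n := fun x => (F x).2
  -- The developing map takes at `x` the value of the germ selected by the section there.
  refine ⟨fun x => (show Rn n ≃ᵃ[ℝ] Rn n from a x) (chartAt (Rn n) x x),
    isDevelopingMap_iff.2 fun x => ⟨a x, ?_⟩⟩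
  -- In the trivialization at `x` the section is continuous with discrete values, hence constant
  -- near `x`. So a single germ `a x ∘ chartAt x` represents it on a whole neighbourhood.
  have hc : ContinuousAt (fun y => ((Z.localTriv (achart (Rn n) x)) (F y)).2) x := by
    refine continuousAt_snd.comp (ContinuousAt.comp (g := Z.localTriv (achart (Rn n) x)) ?_
      F.continuous.continuousAt)
    refine (Z.localTriv (achart (Rn n) x)).continuousAt ?_
    rw [Z.mem_localTriv_source]
    change (F x).proj ∈ (chartAt (Rn n) x).source
    rw [hproj]
    exact mem_chart_source _ x
  have hform : ∀ y, ((Z.localTriv (achart (Rn n) x)) (F y)).2 =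
      (affineTransition (achart (Rn n) x) (achart (Rn n) y) y).trans (a y) := by
    intro y
    change (affineTransition (achart (Rn n) x) (achart (Rn n) (F y).proj) (F y).proj).trans (a y)
      = _
    rw [hproj]
  have hloc : ∀ᶠ y in 𝓝 x, ((Z.localTriv (achart (Rn n) x)) (F y)).2 =
      ((Z.localTriv (achart (Rn n) x)) (F x)).2 := by
    have h := hc.tendsto
    rw [nhds_discrete (DiscreteAffine n)] at h
    exact tendsto_pure.1 h
  have hx : ((Z.localTriv (achart (Rn n) x)) (F x)).2 = a x := by
    rw [hform, affineTransition_eq (mem_chart_source _ x) (mem_chart_source _ x)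
      (A := AffineEquiv.refl ℝ (Rn n)) (by rfl)]
    exact AffineEquiv.refl_trans _
  filter_upwards [hloc, (chartAt (Rn n) x).open_source.mem_nhds (mem_chart_source _ x)] with y hy hyx
  rw [hx, hform] at hy
  have h1 := (affineTransition_spec (achart (Rn n) x) (achart (Rn n) y) hyx
    (mem_chart_source _ y)).eq_of_nhds
  simp only [coe_achart, Function.comp_apply] at h1 ⊢
  rw [← hy, h1]
  rfl

end Development

/-! ### The affine holonomy of a developing map -/

section Holonomy

variable {n : ℕ} {M : Type*} [TopologicalSpace M] [ChartedSpace (Rn n) M]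

/-- On a connected manifold, maps which are locally affinely related to a given map with flat germs
are globally affinely related to it. -/
theorem exists_affineEquiv_eq_comp [ConnectedSpace M] {f f' : M → Rn n} (hf : ∀ x, IsFlatAt f x)
    (h : ∀ x, AffineRelatedAt f f' x) : ∃ A : Rn n ≃ᵃ[ℝ] Rn n, ∀ x, f' x = A (f x) := by
  choose A hA using h
  have hloc : IsLocallyConstant A := by
    refine (IsLocallyConstant.iff_eventually_eq A).2 fun x => ?_
    filter_upwards [(hA x).eventually_nhds] with y hy
    exact (hf y).affineEquiv_unique ((hA y).symm.trans hy)
  obtain ⟨x₀⟩ : Nonempty M := inferInstance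
  refine ⟨A x₀, fun x => ?_⟩
  rw [← hloc.apply_eq_of_isPreconnected isPreconnected_univ (mem_univ x) (mem_univ x₀)]
  exact (hA x).eq_of_nhds

theorem IsAffineAut.isFlatAt_comp {a : M ≃ₜ M} (ha : IsAffineAut (n := n) a) {f : M → Rn n}
    {x : M} (hf : IsFlatAt f (a x)) : IsFlatAt (f ∘ a) x := by
  obtain ⟨s, rfl⟩ := ha
  obtain ⟨A, hA⟩ := hf
  have h1 : IsFlatAt (chartAt (Rn n) (s.toHomeomorph x) ∘ s.toHomeomorph) x := by
    have h := s.mem_groupoid _ _ (chart_mem_atlas (Rn n) x)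
      (chart_mem_atlas (Rn n) (s.toHomeomorph x))
    -- The automorphism followed by a chart at the image point serves as a second chart around `x`;
    -- being a structomorphism says that the transition to it is affine.
    exact affineRelatedAt_of_mem_affineGroupoid (mem_chart_source _ x)
      (e' := s.toHomeomorph.toOpenPartialHomeomorph ≫ₕ chartAt (Rn n) (s.toHomeomorph x))
      (by simp) h
  refine h1.trans ⟨A, ?_⟩
  filter_upwards [s.toHomeomorph.continuous.continuousAt.eventually hA] with y hy
  simpa using hy

variable [HasGroupoid M (affineGroupoid n)]

/-- Both `dev` and `dev ∘ a` have flat germs, so they differ by one affine equivalence. Because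
`dev` is open, its image determines an affine map, which gives both multiplicativity and uniqueness.
-/
theorem existsUnique_isDevEquivariant [ConnectedSpace M] {g : RMetric n M} {dev : M → Rn n}
    (hdev : IsDevelopingMap dev) :
    ∃! θ : affineIsometryGroup g →* (Rn n ≃ᵃ[ℝ] Rn n), IsDevEquivariant dev θ := by
  have hf := isDevelopingMap_iff.1 hdev
  obtain ⟨x₀⟩ : Nonempty M := inferInstance
  have huniq : ∀ A B : Rn n ≃ᵃ[ℝ] Rn n, (∀ x, A (dev x) = B (dev x)) → A = B := fun A B h =>
    (hf x₀).affineEquiv_unique (Eventually.of_forall h)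
  have hex : ∀ a : affineIsometryGroup g, ∃ A : Rn n ≃ᵃ[ℝ] Rn n,
      ∀ x, dev ((a : M ≃ₜ M) x) = A (dev x) := fun a =>
    exists_affineEquiv_eq_comp hf fun x =>
      (hf x).affineRelatedAt (a.2.1.isFlatAt_comp (hf ((a : M ≃ₜ M) x)))
  choose A hA using hex
  refine ⟨MonoidHom.mk' A fun a b => huniq _ _ fun x => ?_, hA, fun θ hθ => ?_⟩
  · rw [← hA (a * b) x]
    change dev ((a : M ≃ₜ M) ((b : M ≃ₜ M) x)) = A a (A b (dev x))
    rw [hA, hA]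
  · refine MonoidHom.ext fun a => huniq _ _ fun x => ?_
    rw [← hθ a x, hA a x]
    rfl

end Holonomy

/-! ### Coordinates of the tangent bundle induced by flat maps -/

section FlatCoord

variable {n : ℕ} {M : Type*} [TopologicalSpace M] [ChartedSpace (Rn n) M]
  [HasGroupoid M (affineGroupoid n)]

/-- The map `TM → ℝⁿ × ℝⁿ`, `(m, v) ↦ (f(m), df_m(v))` induced by a map `f : M → ℝⁿ`. -/
def flatCoord (f : M → Rn n) (p : TanB n M) : Rn n × Rn n :=
  (f p.proj, mfderiv 𝓘(ℝ, Rn n) 𝓘(ℝ, Rn n) f p.proj p.2)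

/-- The differential of the map induced on `TM` by `f : M → ℝⁿ`. -/
def dFlatCoord (f : M → Rn n) (p : TanB n M) :
    TangentSpace 𝓘(ℝ, Rn n).tangent p →L[ℝ] Rn n × Rn n :=
  mfderiv 𝓘(ℝ, Rn n).tangent 𝓘(ℝ, Rn n × Rn n) (flatCoord f) p

theorem dTangentCoord_eq_dFlatCoord (e : OpenPartialHomeomorph M (Rn n)) :
    dTangentCoord e = dFlatCoord e := rfl

theorem isFlatAt_chartAt {x y : M} (hy : y ∈ (chartAt (Rn n) x).source) :
    IsFlatAt (chartAt (Rn n) x) y :=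
  flatCharts_isFlatAt (chartAt_mem_flatCharts x) hy

/-- The transformation of `ℝⁿ × ℝⁿ` induced by an affine transformation of `ℝⁿ`. -/
def AffineEquiv.tangentProd (A : Rn n ≃ᵃ[ℝ] Rn n) (z : Rn n × Rn n) : Rn n × Rn n :=
  (A z.1, A.linear z.2)

theorem AffineEquiv.hasFDerivAt_tangentProd (A : Rn n ≃ᵃ[ℝ] Rn n) (z : Rn n × Rn n) :
    HasFDerivAt A.tangentProd
      ((A.linearCLE : Rn n →L[ℝ] Rn n).prodMap (A.linearCLE : Rn n →L[ℝ] Rn n)) z :=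
  HasFDerivAt.prodMap z (A.hasFDerivAt z.1) A.linearCLE.hasFDerivAt

theorem tendsto_proj (p : TanB n M) :
    Tendsto (fun q : TanB n M => q.proj) (𝓝 p) (𝓝 p.proj) :=
  (FiberBundle.continuous_proj (Rn n) (TangentSpace 𝓘(ℝ, Rn n) : M → Type _)).continuousAt

theorem flatCoord_eventuallyEq {f f' : M → Rn n} {p : TanB n M} (hf : IsFlatAt f p.proj)
    {A : Rn n ≃ᵃ[ℝ] Rn n} (hA : f' =ᶠ[𝓝 p.proj] A ∘ f) :
    flatCoord f' =ᶠ[𝓝 p] A.tangentProd ∘ flatCoord f := by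
  filter_upwards [(tendsto_proj p).eventually hf.eventually,
    (tendsto_proj p).eventually hA.eventually_nhds] with q h1 (h2 : ∀ᶠ y in 𝓝 q.proj, f' y = (A ∘ f) y)
  exact Prod.ext h2.self_of_nhds (h1.mfderiv_of_eventuallyEq h2 q.2)

/-- This ties the manifold structure of `TM` to the coordinates `(f, df)`, so that smoothness and
invertibility can be imported from the charts of `TM`. -/
theorem flatCoord_chartAt {p q : TanB n M} (hq : q.proj ∈ (chartAt (Rn n) p.proj).source) :
    extChartAt 𝓘(ℝ, Rn n).tangent p q = flatCoord (chartAt (Rn n) p.proj) q := by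
  have h := tangentMap_chart (I := 𝓘(ℝ, Rn n)) hq
  exact (congrArg (TotalSpace.toProd (Rn n) (Rn n)) h).symm

theorem mem_extChartAt_tangent_source {p q : TanB n M} :
    q ∈ (extChartAt 𝓘(ℝ, Rn n).tangent p).source ↔ q.proj ∈ (chartAt (Rn n) p.proj).source := by
  rw [extChartAt_source]
  exact TangentBundle.mem_chart_source_iff q p

theorem flatCoord_chartAt_eventuallyEq {p q : TanB n M}
    (hq : q.proj ∈ (chartAt (Rn n) p.proj).source) :
    extChartAt 𝓘(ℝ, Rn n).tangent p =ᶠ[𝓝 q] flatCoord (chartAt (Rn n) p.proj) := by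
  filter_upwards [(tendsto_proj q).eventually ((chartAt (Rn n) p.proj).open_source.mem_nhds hq)]
    with r hr
  exact flatCoord_chartAt hr

theorem mfderiv_extChartAt_eq_dFlatCoord {p q : TanB n M}
    (hq : q.proj ∈ (chartAt (Rn n) p.proj).source) :
    mfderiv 𝓘(ℝ, Rn n).tangent 𝓘(ℝ, Rn n × Rn n) (extChartAt 𝓘(ℝ, Rn n).tangent p) q =
      dFlatCoord (chartAt (Rn n) p.proj) q :=
  (flatCoord_chartAt_eventuallyEq hq).mfderiv_eq

theorem contMDiffAt_flatCoord {f : M → Rn n} {p : TanB n M} (hf : IsFlatAt f p.proj) :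
    ContMDiffAt 𝓘(ℝ, Rn n).tangent 𝓘(ℝ, Rn n × Rn n) ∞ (flatCoord f) p := by
  obtain ⟨A, hA⟩ := hf
  have hm := mem_chart_source (Rn n) p.proj
  refine ContMDiffAt.congr_of_eventuallyEq ?_ (flatCoord_eventuallyEq (isFlatAt_chartAt hm) hA)
  have h1 : ContDiff ℝ ∞ A.tangentProd :=
    (A.contDiff_of_finiteDimensional.comp contDiff_fst).prodMk
      (A.linearCLE.contDiff.comp contDiff_snd)
  refine ContMDiffAt.comp p h1.contMDiff.contMDiffAt ?_
  exact contMDiffAt_extChartAt.congr_of_eventuallyEq (flatCoord_chartAt_eventuallyEq hm).symm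

theorem mdifferentiableAt_flatCoord {f : M → Rn n} {p : TanB n M} (hf : IsFlatAt f p.proj) :
    MDifferentiableAt 𝓘(ℝ, Rn n).tangent 𝓘(ℝ, Rn n × Rn n) (flatCoord f) p :=
  (contMDiffAt_flatCoord hf).mdifferentiableAt (by simp)

/-- The linear part of `A` is constant, so no second derivative of the coordinate change mixes the
base and fibre directions; for a general smooth change it would. -/
theorem dFlatCoord_of_eventuallyEq {f f' : M → Rn n} {p : TanB n M} (hf : IsFlatAt f p.proj)
    {A : Rn n ≃ᵃ[ℝ] Rn n} (hA : f' =ᶠ[𝓝 p.proj] A ∘ f) :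
    dFlatCoord f' p = ((A.linearCLE : Rn n →L[ℝ] Rn n).prodMap
      (A.linearCLE : Rn n →L[ℝ] Rn n)) ∘L dFlatCoord f p := by
  have hP := (A.hasFDerivAt_tangentProd (flatCoord f p)).hasMFDerivAt
  rw [dFlatCoord, (flatCoord_eventuallyEq hf hA).mfderiv_eq,
    mfderiv_comp p hP.mdifferentiableAt (mdifferentiableAt_flatCoord hf), hP.mfderiv]
  rfl

theorem dFlatCoord_isInvertible {f : M → Rn n} {p : TanB n M} (hf : IsFlatAt f p.proj) :
    (dFlatCoord f p).IsInvertible := by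
  obtain ⟨A, hA⟩ := hf
  have hm := mem_chart_source (Rn n) p.proj
  have h2 : (dFlatCoord (chartAt (Rn n) p.proj) p).IsInvertible := by
    rw [← mfderiv_extChartAt_eq_dFlatCoord hm]
    exact isInvertible_mfderiv_extChartAt (I := 𝓘(ℝ, Rn n).tangent) (mem_extChartAt_source p)
  obtain ⟨L, hL⟩ := h2
  refine ⟨L.trans (A.linearCLE.prodCongr A.linearCLE), ?_⟩
  rw [dFlatCoord_of_eventuallyEq (isFlatAt_chartAt hm) hA, ← hL]
  rfl

theorem dFlatCoord_injective {f : M → Rn n} {p : TanB n M} (hf : IsFlatAt f p.proj) :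
    Function.Injective (dFlatCoord f p) := (dFlatCoord_isInvertible hf).injective

theorem stdComplex_apply (z : Rn n × Rn n) : stdComplex n z = (-z.2, z.1) := rfl

/-- It holds by definition for the preferred chart, and any other flat germ differs from it by two
equal diagonal blocks, which commute with `stdComplex`. -/
theorem dFlatCoord_affineComplex {f : M → Rn n} {p : TanB n M} (hf : IsFlatAt f p.proj)
    (X : TangentSpace 𝓘(ℝ, Rn n).tangent p) :
    dFlatCoord f p (affineComplex n M p X) = stdComplex n (dFlatCoord f p X) := by
  have hc := isFlatAt_chartAt (mem_chart_source (Rn n) p.proj)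
  have h0 : dFlatCoord (chartAt (Rn n) p.proj) p (affineComplex n M p X) =
      stdComplex n (dFlatCoord (chartAt (Rn n) p.proj) p X) := by
    have h := dFlatCoord_isInvertible hc
    change dFlatCoord (chartAt (Rn n) p.proj) p
      ((dFlatCoord (chartAt (Rn n) p.proj) p).inverse _) = _
    rw [h.self_apply_inverse]
    rfl
  obtain ⟨A, hA⟩ := hf
  rw [dFlatCoord_of_eventuallyEq hc hA, ContinuousLinearMap.comp_apply,
    ContinuousLinearMap.comp_apply, h0]
  simp [stdComplex_apply]

theorem affineComplex_sq (p : TanB n M) (X : TangentSpace 𝓘(ℝ, Rn n).tangent p) :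
    affineComplex n M p (affineComplex n M p X) = -X := by
  have hc := isFlatAt_chartAt (mem_chart_source (Rn n) p.proj)
  apply dFlatCoord_injective hc
  rw [dFlatCoord_affineComplex hc, dFlatCoord_affineComplex hc, map_neg]
  rfl

theorem mdifferentiableAt_proj (p : TanB n M) :
    MDifferentiableAt 𝓘(ℝ, Rn n).tangent 𝓘(ℝ, Rn n) (fun q : TanB n M => q.proj) p :=
  (contMDiff_proj (TangentSpace 𝓘(ℝ, Rn n) : M → Type _) (n := 1) p).mdifferentiableAt one_ne_zero

/-- Differentiate `f ∘ π = Prod.fst ∘ flatCoord f`. -/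
theorem mfderiv_dProj {f : M → Rn n} {p : TanB n M} (hf : IsFlatAt f p.proj)
    (X : TangentSpace 𝓘(ℝ, Rn n).tangent p) :
    mfderiv 𝓘(ℝ, Rn n) 𝓘(ℝ, Rn n) f p.proj (dProj p X) = (dFlatCoord f p X).1 := by
  have h1 := mfderiv_comp p hf.mdifferentiableAt (mdifferentiableAt_proj p)
  have h2 := mfderiv_comp p (I'' := 𝓘(ℝ, Rn n))
    (hasFDerivAt_fst (𝕜 := ℝ) (p := flatCoord f p)).hasMFDerivAt.mdifferentiableAt
    (mdifferentiableAt_flatCoord hf)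
  have h3 : f ∘ (fun q : TanB n M => q.proj) = Prod.fst ∘ flatCoord f := rfl
  rw [h3, h2, (hasFDerivAt_fst (𝕜 := ℝ) (p := flatCoord f p)).hasMFDerivAt.mfderiv] at h1
  exact (congrArg (fun L : TangentSpace 𝓘(ℝ, Rn n).tangent p →L[ℝ] Rn n => L X) h1).symm

theorem mfderiv_dProj_affineComplex {f : M → Rn n} {p : TanB n M} (hf : IsFlatAt f p.proj)
    (X : TangentSpace 𝓘(ℝ, Rn n).tangent p) :
    mfderiv 𝓘(ℝ, Rn n) 𝓘(ℝ, Rn n) f p.proj (dProj p (affineComplex n M p X)) =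
      -(dFlatCoord f p X).2 := by
  rw [mfderiv_dProj hf, dFlatCoord_affineComplex hf]
  rfl

end FlatCoord

/-! ### The flat trivialization of the tangent bundle -/

section FlatTriv

variable {n : ℕ} {M : Type*} [TopologicalSpace M] [ChartedSpace (Rn n) M]
  [HasGroupoid M (affineGroupoid n)]

/-- The inverse of the flat trivialization of the tangent bundle. -/
def flatTrivInv (dev : M → Rn n) (z : M × Rn n) : TanB n M :=
  ⟨z.1, (mfderiv 𝓘(ℝ, Rn n) 𝓘(ℝ, Rn n) dev z.1).inverse z.2⟩

variable {dev : M → Rn n}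

theorem flatTrivInv_flatTriv (h : ∀ x, IsFlatAt dev x) (p : TanB n M) :
    flatTrivInv dev (flatTriv dev p) = p :=
  congrArg (TotalSpace.mk p.proj) ((h p.proj).mfderiv_isInvertible.inverse_apply_self p.2)

theorem flatTriv_flatTrivInv (h : ∀ x, IsFlatAt dev x) (z : M × Rn n) :
    flatTriv dev (flatTrivInv dev z) = z :=
  Prod.ext rfl ((h z.1).mfderiv_isInvertible.self_apply_inverse z.2)

theorem contMDiff_flatTriv (h : ∀ x, IsFlatAt dev x) :
    ContMDiff 𝓘(ℝ, Rn n).tangent (𝓘(ℝ, Rn n).prod 𝓘(ℝ, Rn n)) ∞ (flatTriv dev) := by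
  intro p
  refine ContMDiffAt.prodMk (contMDiff_proj (TangentSpace 𝓘(ℝ, Rn n) : M → Type _) p) ?_
  exact ContMDiffAt.comp p (contDiff_snd (𝕜 := ℝ)).contMDiff.contMDiffAt
    (contMDiffAt_flatCoord (h p.proj))

/-- Where `dev = A ∘ chart`, the inverse is an inverse chart of `TM` composed with the chart on `M`
and the constant map `A.linear⁻¹` on vectors. -/
theorem contMDiff_flatTrivInv (h : ∀ x, IsFlatAt dev x) :
    ContMDiff (𝓘(ℝ, Rn n).prod 𝓘(ℝ, Rn n)) 𝓘(ℝ, Rn n).tangent ∞ (flatTrivInv dev) := by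
  rintro ⟨m₀, w₀⟩
  obtain ⟨A, hA⟩ := h m₀
  let p₀ : TanB n M := ⟨m₀, 0⟩
  have hm : m₀ ∈ (chartAt (Rn n) m₀).source := mem_chart_source _ m₀
  let F : M × Rn n → Rn n × Rn n := fun z => (chartAt (Rn n) m₀ z.1, A.linearCLE.symm z.2)
  have hev : flatTrivInv dev =ᶠ[𝓝 (m₀, w₀)] (extChartAt 𝓘(ℝ, Rn n).tangent p₀).symm ∘ F := by
    have hfst : Tendsto Prod.fst (𝓝 (m₀, w₀)) (𝓝 m₀) := continuousAt_fst
    filter_upwards [hfst.eventually hA.eventually_nhds,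
      hfst.eventually ((chartAt (Rn n) m₀).open_source.mem_nhds hm)]
      with z (hz : ∀ᶠ y in 𝓝 z.1, dev y = (A ∘ chartAt (Rn n) m₀) y)
        (hzm : (flatTrivInv dev z).proj ∈ (chartAt (Rn n) p₀.proj).source)
    have h1 : extChartAt 𝓘(ℝ, Rn n).tangent p₀ (flatTrivInv dev z) = F z := by
      rw [flatCoord_chartAt hzm]
      refine Prod.ext rfl (A.linear.injective ?_)
      refine Eq.trans ?_ (A.linearCLE.apply_symm_apply z.2).symm
      refine ((isFlatAt_chartAt hzm).mfderiv_of_eventuallyEq hz _).symm.trans ?_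
      exact (h z.1).mfderiv_isInvertible.self_apply_inverse z.2
    rw [Function.comp_apply, ← h1]
    exact ((extChartAt 𝓘(ℝ, Rn n).tangent p₀).left_inv
      (mem_extChartAt_tangent_source.2 hzm)).symm
  refine ContMDiffAt.congr_of_eventuallyEq ?_ hev
  have hF : ContMDiffAt (𝓘(ℝ, Rn n).prod 𝓘(ℝ, Rn n)) 𝓘(ℝ, Rn n × Rn n) ∞ F (m₀, w₀) := by
    refine ContMDiffAt.prodMk_space ?_ ?_
    · exact ContMDiffAt.comp (m₀, w₀) (g := chartAt (Rn n) m₀) (I' := 𝓘(ℝ, Rn n))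
        (isFlatAt_chartAt hm).contMDiffAt contMDiffAt_fst
    · exact ContMDiffAt.comp (m₀, w₀) (I' := 𝓘(ℝ, Rn n))
        A.linearCLE.symm.contDiff.contMDiff.contMDiffAt contMDiffAt_snd
  refine ContMDiffAt.comp (m₀, w₀) (I' := 𝓘(ℝ, Rn n × Rn n)) ?_ hF
  have ht : F (m₀, w₀) ∈ (extChartAt 𝓘(ℝ, Rn n).tangent p₀).target := by
    rw [extChartAt_target]
    have := (TangentBundle.mem_chart_target_iff (I := 𝓘(ℝ, Rn n)) (F (m₀, w₀)) p₀).2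
      ((chartAt (Rn n) m₀).map_source hm)
    exact ⟨this, by rw [ModelWithCorners.range_eq_univ]; trivial⟩
  exact (contMDiffOn_extChartAt_symm p₀).contMDiffAt
    ((isOpen_extChartAt_target p₀).mem_nhds ht)

/-- The flat trivialization of the tangent bundle, as a diffeomorphism. -/
def flatTrivDiffeomorph (h : ∀ x, IsFlatAt dev x) :
    Diffeomorph 𝓘(ℝ, Rn n).tangent (𝓘(ℝ, Rn n).prod 𝓘(ℝ, Rn n)) (TanB n M) (M × Rn n) ∞ where
  toFun := flatTriv dev
  invFun := flatTrivInv dev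
  left_inv := flatTrivInv_flatTriv h
  right_inv := flatTriv_flatTrivInv h
  contMDiff_toFun := contMDiff_flatTriv h
  contMDiff_invFun := contMDiff_flatTrivInv h

theorem flatTriv_injective (h : ∀ x, IsFlatAt dev x) : Function.Injective (flatTriv dev) :=
  (flatTrivDiffeomorph h).injective

/-! ### The action on the tangent bundle -/

variable {g : RMetric n M} {θ : affineIsometryGroup g →* (Rn n ≃ᵃ[ℝ] Rn n)}

theorem flatTriv_psi (h : ∀ x, IsFlatAt dev x) (k : AffSemidirect θ) (p : TanB n M) :
    flatTriv dev (psi dev θ k p) = ((k.right : M ≃ₜ M) p.proj,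
      θ k.right (flatTriv dev p).2 + Multiplicative.toAdd k.left) :=
  flatTriv_flatTrivInv h ((k.right : M ≃ₜ M) p.proj,
    θ k.right (flatTriv dev p).2 + Multiplicative.toAdd k.left)

theorem isGroupAction_psi (h : ∀ x, IsFlatAt dev x) : IsGroupAction (psi dev θ) := by
  refine ⟨fun p => flatTriv_injective h ?_, fun k l p => flatTriv_injective h ?_⟩
  · rw [flatTriv_psi h, SemidirectProduct.one_right, SemidirectProduct.one_left, map_one]
    exact Prod.ext rfl (add_zero _)
  · rw [flatTriv_psi h, flatTriv_psi h, flatTriv_psi h, SemidirectProduct.mul_right,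
      SemidirectProduct.mul_left, map_mul]
    refine Prod.ext rfl ?_
    change θ k.right (θ l.right (flatTriv dev p).2) + (Multiplicative.toAdd k.left +
      (θ k.right).linear (Multiplicative.toAdd l.left)) =
      θ k.right (θ l.right (flatTriv dev p).2 + Multiplicative.toAdd l.left) +
        Multiplicative.toAdd k.left
    -- An affine map turns the addition of a vector into the addition of its image under the linear
    -- part, which matches the twist in the semidirect product.
    rw [add_comm (θ l.right _), ← vadd_eq_add (Multiplicative.toAdd l.left), AffineEquiv.map_vadd,
      vadd_eq_add]
    abel

/-- The group `G` matches the base points, and a translation then corrects the fibre component. -/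
theorem isTransitive_psi (h : ∀ x, IsFlatAt dev x)
    (ht : IsTransitive fun (a : affineIsometryGroup g) (m : M) => (a : M ≃ₜ M) m) :
    IsTransitive (psi dev θ) := by
  intro p q
  obtain ⟨a, ha⟩ := ht p.proj q.proj
  refine ⟨⟨Multiplicative.ofAdd ((flatTriv dev q).2 - θ a (flatTriv dev p).2), a⟩,
    flatTriv_injective h ?_⟩
  rw [flatTriv_psi h]
  exact Prod.ext ha (add_sub_cancel _ _)

theorem contMDiff_psi (h : ∀ x, IsFlatAt dev x) (k : AffSemidirect θ) :
    ContMDiff 𝓘(ℝ, Rn n).tangent 𝓘(ℝ, Rn n).tangent ∞ (psi dev θ k) := by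
  have h1 : ContMDiff (𝓘(ℝ, Rn n).prod 𝓘(ℝ, Rn n)) (𝓘(ℝ, Rn n).prod 𝓘(ℝ, Rn n)) ∞
      (fun z : M × Rn n => ((k.right : M ≃ₜ M) z.1, θ k.right z.2 + Multiplicative.toAdd k.left)) :=
    (k.right.2.1.contMDiff.comp contMDiff_fst).prodMk
      (((θ k.right).contDiff_of_finiteDimensional.add contDiff_const).contMDiff.comp
        contMDiff_snd)
  exact (contMDiff_flatTrivInv h).comp (h1.comp (contMDiff_flatTriv h))

/-- In the coordinates `(dev, d dev)` the action is `(x, y) ↦ (θ_a x, θ_a y + u)`: the first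
component by equivariance, the second by the formula for `ψ`. -/
theorem dFlatCoord_psi (h : ∀ x, IsFlatAt dev x) (hθ : IsDevEquivariant dev θ)
    (k : AffSemidirect θ) (p : TanB n M) (X : TangentSpace 𝓘(ℝ, Rn n).tangent p) :
    dFlatCoord dev (psi dev θ k p)
        (mfderiv 𝓘(ℝ, Rn n).tangent 𝓘(ℝ, Rn n).tangent (psi dev θ k) p X) =
      ((θ k.right).linear (dFlatCoord dev p X).1, (θ k.right).linear (dFlatCoord dev p X).2) := by
  let T : Rn n × Rn n → Rn n × Rn n := fun z =>
    (θ k.right z.1, θ k.right z.2 + Multiplicative.toAdd k.left)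
  have hT : HasFDerivAt T (((θ k.right).linearCLE : Rn n →L[ℝ] Rn n).prodMap
      ((θ k.right).linearCLE : Rn n →L[ℝ] Rn n)) (flatCoord dev p) :=
    HasFDerivAt.prodMap (flatCoord dev p) ((θ k.right).hasFDerivAt _)
      (((θ k.right).hasFDerivAt _).add_const _)
  have hcomp : flatCoord dev ∘ psi dev θ k = T ∘ flatCoord dev := by
    funext q
    have h2 := congrArg Prod.snd (flatTriv_psi h k q)
    exact Prod.ext (hθ k.right q.proj) h2
  have h1 := mfderiv_comp p (mdifferentiableAt_flatCoord (h _))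
    ((contMDiff_psi h k p).mdifferentiableAt (by simp))
  rw [hcomp, mfderiv_comp p hT.hasMFDerivAt.mdifferentiableAt (mdifferentiableAt_flatCoord (h _)),
    hT.hasMFDerivAt.mfderiv] at h1
  exact (congrArg (fun L : TangentSpace 𝓘(ℝ, Rn n).tangent p →L[ℝ] Rn n × Rn n => L X) h1).symm

theorem dProj_psi (h : ∀ x, IsFlatAt dev x) (k : AffSemidirect θ) (p : TanB n M)
    (X : TangentSpace 𝓘(ℝ, Rn n).tangent p) :
    dProj (psi dev θ k p) (mfderiv 𝓘(ℝ, Rn n).tangent 𝓘(ℝ, Rn n).tangent (psi dev θ k) p X) =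
      mfderiv 𝓘(ℝ, Rn n) 𝓘(ℝ, Rn n) (k.right : M ≃ₜ M) p.proj (dProj p X) := by
  have h1 := mfderiv_comp p (mdifferentiableAt_proj (psi dev θ k p))
    ((contMDiff_psi h k p).mdifferentiableAt (by simp))
  have h2 := mfderiv_comp p ((k.right.2.1.contMDiff p.proj).mdifferentiableAt (by simp))
    (mdifferentiableAt_proj p)
  have h3 := h1.symm.trans h2
  exact congrArg (fun L : TangentSpace 𝓘(ℝ, Rn n).tangent p →L[ℝ] Rn n => L X) h3

theorem isInvariantUnder_psi (h : ∀ x, IsFlatAt dev x) (hθ : IsDevEquivariant dev θ) :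
    IsInvariantUnder 𝓘(ℝ, Rn n).tangent (affineComplex n M) (rMetric g) (psi dev θ) := by
  intro k
  have hJ : ∀ (p : TanB n M) (X : TangentSpace 𝓘(ℝ, Rn n).tangent p),
      mfderiv 𝓘(ℝ, Rn n).tangent 𝓘(ℝ, Rn n).tangent (psi dev θ k) p (affineComplex n M p X) =
        affineComplex n M (psi dev θ k p)
          (mfderiv 𝓘(ℝ, Rn n).tangent 𝓘(ℝ, Rn n).tangent (psi dev θ k) p X) := by
    intro p X
    apply dFlatCoord_injective (h (psi dev θ k p).proj)
    rw [dFlatCoord_psi h hθ, dFlatCoord_affineComplex (h _), dFlatCoord_affineComplex (h _),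
      dFlatCoord_psi h hθ]
    simp [stdComplex_apply]
  refine ⟨contMDiff_psi h k, hJ, fun p X Y => ?_⟩
  rw [rMetric, ← hJ, ← hJ, dProj_psi h, dProj_psi h, dProj_psi h, dProj_psi h]
  exact congrArg₂ (· + ·) (k.right.2.2 _ _ _) (k.right.2.2 _ _ _)

end FlatTriv

/-! ### Bilinear forms and tangent vectors in charts -/

/-- By compactness `B` has a minimum `c > 0` on the unit sphere, so `B v v < 1` forces `c‖v‖² < 1`.
-/
theorem isVonNBounded_of_posDef {F : Type*} [NormedAddCommGroup F] [NormedSpace ℝ F]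
    [FiniteDimensional ℝ F] (B : F →L[ℝ] F →L[ℝ] ℝ) (hB : ∀ v, v ≠ 0 → 0 < B v v) :
    Bornology.IsVonNBounded ℝ {v : F | B v v < 1} := by
  rcases (Metric.sphere (0 : F) 1).eq_empty_or_nonempty with hs | hs
  · have : {v : F | B v v < 1} ⊆ {0} := fun v _ => by
      by_contra hv
      have : ‖v‖⁻¹ • v ∈ Metric.sphere (0 : F) 1 := by
        simp [norm_smul, inv_mul_cancel₀ (norm_ne_zero_iff.2 hv)]
      simp [hs] at this
    exact (Bornology.isVonNBounded_singleton (0 : F)).subset this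
  · have hcont : Continuous fun v : F => B v v := by fun_prop
    obtain ⟨v₀, hv₀, hmin⟩ := (isCompact_sphere (0 : F) 1).exists_isMinOn hs hcont.continuousOn
    have hc : 0 < B v₀ v₀ := hB v₀ (by rintro rfl; simp at hv₀)
    refine NormedSpace.isVonNBounded_of_isBounded ℝ
      -- The radius `c⁻¹ + 1` avoids a square root: beyond it `‖v‖ > 1`, hence `‖v‖² ≥ ‖v‖ ≥ c⁻¹`.
      ((Metric.isBounded_closedBall (x := (0 : F)) (r := (B v₀ v₀)⁻¹ + 1)).subset fun v hv => ?_)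
    rw [mem_closedBall_zero_iff]
    by_contra! hlt
    have hpos : 0 < (B v₀ v₀)⁻¹ := inv_pos.2 hc
    have hv0 : 0 < ‖v‖ := by linarith
    have h1 : B v₀ v₀ ≤ B (‖v‖⁻¹ • v) (‖v‖⁻¹ • v) := hmin (by
      simp [norm_smul, inv_mul_cancel₀ hv0.ne'])
    simp only [map_smul, smul_apply, smul_eq_mul] at h1
    have h2 : B v₀ v₀ * (‖v‖ * ‖v‖) ≤ B v v := by
      have := mul_le_mul_of_nonneg_right h1 (mul_pos hv0 hv0).le
      field_simp at this
      nlinarith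
    have h3 : 1 ≤ B v₀ v₀ * (‖v‖ * ‖v‖) := by
      have h4 : B v₀ v₀ * (B v₀ v₀)⁻¹ = 1 := mul_inv_cancel₀ hc.ne'
      have h5 : (B v₀ v₀)⁻¹ ≤ ‖v‖ * ‖v‖ := by nlinarith
      nlinarith
    have : B v v < 1 := hv
    linarith

/-- The product bilinear form on `E × E` given by two copies of a bilinear form on `E`. -/
def doubleForm (E : Type*) [NormedAddCommGroup E] [NormedSpace ℝ E] (B : E →L[ℝ] E →L[ℝ] ℝ) :
    E × E →L[ℝ] E × E →L[ℝ] ℝ :=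
  B.bilinearComp (.fst ℝ _ _) (.fst ℝ _ _) + B.bilinearComp (.snd ℝ _ _) (.snd ℝ _ _)

theorem contDiff_bilinearComp {E E' : Type*} [NormedAddCommGroup E] [NormedSpace ℝ E]
    [NormedAddCommGroup E'] [NormedSpace ℝ E'] (f : E' →L[ℝ] E) {k : WithTop ℕ∞} :
    ContDiff ℝ k (fun B : E →L[ℝ] E →L[ℝ] ℝ => B.bilinearComp f f) := by
  have h : (fun B : E →L[ℝ] E →L[ℝ] ℝ => B.bilinearComp f f) =
    fun B => ((ContinuousLinearMap.compL ℝ E' E ℝ).flip f) ∘L B ∘L f := rfl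
  rw [h]
  fun_prop

theorem contDiff_doubleForm {E : Type*} [NormedAddCommGroup E] [NormedSpace ℝ E]
    {k : WithTop ℕ∞} : ContDiff ℝ k (doubleForm E) :=
  (contDiff_bilinearComp (.fst ℝ E E)).add (contDiff_bilinearComp (.snd ℝ E E))

section General

variable {F : Type*} [NormedAddCommGroup F] [NormedSpace ℝ F] {H : Type*} [TopologicalSpace H]
  {I : ModelWithCorners ℝ F H} {N : Type*} [TopologicalSpace N] [ChartedSpace H N]
  [IsManifold I ∞ N]

/-- The tangent trivialization at `x₀` is fibrewise the differential of the chart. -/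
theorem mfderiv_extChartAt_trivializationAt_symm {x₀ x : N} (hx : x ∈ (chartAt H x₀).source)
    (v : F) : mfderiv I 𝓘(ℝ, F) (extChartAt I x₀) x
      ((trivializationAt F (TangentSpace I : N → Type _) x₀).symm x v) = v := by
  have : IsManifold I 1 N := .of_le (n := ∞) (by simp)
  rw [← TangentBundle.continuousLinearMapAt_trivializationAt hx]
  rw [← Trivialization.symmL_apply (R := ℝ) _ hx]
  exact (trivializationAt F (TangentSpace I : N → Type _) x₀).continuousLinearMapAt_symmL
    (R := ℝ) (b := x) hx v

theorem mfderiv_extChartAt_comp_mfderiv_symm [I.Boundaryless] {x₀ : N} {y : F}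
    (hy : y ∈ (extChartAt I x₀).target) (v : F) :
    mfderiv I 𝓘(ℝ, F) (extChartAt I x₀) ((extChartAt I x₀).symm y)
      (mfderiv 𝓘(ℝ, F) I (extChartAt I x₀).symm y v) = v := by
  have : IsManifold I 1 N := .of_le (n := ∞) (by simp)
  have h := mfderiv_extChartAt_comp_mfderivWithin_extChartAt_symm hy
  rw [ModelWithCorners.range_eq_univ, mfderivWithin_univ] at h
  exact congrArg (fun L : F →L[ℝ] F => L v) h

/-- The bilinear form `B p` on the tangent space at `p`, read in the preferred chart at `p₀`. -/
def bilinInChart (B : ∀ p : N, TangentSpace I p →L[ℝ] TangentSpace I p →L[ℝ] ℝ) (p₀ p : N) :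
    F →L[ℝ] F →L[ℝ] ℝ :=
  ContinuousLinearMap.inCoordinates F (TangentSpace I : N → Type _) (F →L[ℝ] ℝ)
    (fun p : N => TangentSpace I p →L[ℝ] ℝ) p₀ p p₀ p (B p)

theorem bilinInChart_apply (B : ∀ p : N, TangentSpace I p →L[ℝ] TangentSpace I p →L[ℝ] ℝ)
    {p₀ p : N} (hp : p ∈ (chartAt H p₀).source) (v w : F) :
    bilinInChart B p₀ p v w = B p
      ((trivializationAt F (TangentSpace I : N → Type _) p₀).symm p v)
      ((trivializationAt F (TangentSpace I : N → Type _) p₀).symm p w) := by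
  have h := inCoordinates_apply_eq₂ (𝕜 := ℝ) (E₁ := (TangentSpace I : N → Type _))
    (E₂ := (TangentSpace I : N → Type _)) (E₃ := Bundle.Trivial N ℝ) (F₁ := F) (F₂ := F) (F₃ := ℝ)
    (x₀ := p₀) (x := p) (ϕ := B p) (v := v) (w := w) (by simpa using hp) (by simpa using hp)
    (mem_univ p)
  refine Eq.trans h ?_
  simp

theorem contMDiffAt_bilin_iff {B : ∀ p : N, TangentSpace I p →L[ℝ] TangentSpace I p →L[ℝ] ℝ}
    {p₀ : N} :
    ContMDiffAt I (I.prod 𝓘(ℝ, F →L[ℝ] F →L[ℝ] ℝ)) ∞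
      (fun p => TotalSpace.mk' (F →L[ℝ] F →L[ℝ] ℝ)
        (E := fun p : N => TangentSpace I p →L[ℝ] TangentSpace I p →L[ℝ] ℝ) p (B p)) p₀ ↔
    ContMDiffAt I 𝓘(ℝ, F →L[ℝ] F →L[ℝ] ℝ) ∞ (bilinInChart B p₀) p₀ := by
  rw [contMDiffAt_hom_bundle]
  exact ⟨fun h => h.2, fun h => ⟨contMDiffAt_id, h⟩⟩

theorem mfderiv_extChartAt_injective {x₀ x : N} (hx : x ∈ (chartAt H x₀).source) :
    Function.Injective (mfderiv I 𝓘(ℝ, F) (extChartAt I x₀) x) := by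
  have : IsManifold I 1 N := .of_le (n := ∞) (by simp)
  exact (isInvertible_mfderiv_extChartAt (I := I) (by rwa [extChartAt_source])).injective

theorem trivializationAt_symm_mfderiv {x₀ x : N} (hx : x ∈ (chartAt H x₀).source)
    (X : TangentSpace I x) :
    (trivializationAt F (TangentSpace I : N → Type _) x₀).symm x
      (mfderiv I 𝓘(ℝ, F) (extChartAt I x₀) x X) = X :=
  mfderiv_extChartAt_injective hx (mfderiv_extChartAt_trivializationAt_symm hx _)

theorem bilinInChart_mfderiv (B : ∀ p : N, TangentSpace I p →L[ℝ] TangentSpace I p →L[ℝ] ℝ)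
    {p₀ p : N} (hp : p ∈ (chartAt H p₀).source) (X Y : TangentSpace I p) :
    bilinInChart B p₀ p (mfderiv I 𝓘(ℝ, F) (extChartAt I p₀) p X)
      (mfderiv I 𝓘(ℝ, F) (extChartAt I p₀) p Y) = B p X Y := by
  refine (bilinInChart_apply B hp _ _).trans ?_
  rw [trivializationAt_symm_mfderiv hp, trivializationAt_symm_mfderiv hp]

end General

/-- The restriction of scalars identification `ℝⁿ × ℝⁿ = ℂⁿ`, `(x, y) ↦ x + i y`. -/
def prodEquivComplex (n : ℕ) : (Rn n × Rn n) ≃L[ℝ] EuclideanSpace ℂ (Fin n) :=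
  LinearEquiv.toContinuousLinearEquiv
    { toFun := fun z => WithLp.toLp 2 fun i => (⟨z.1 i, z.2 i⟩ : ℂ)
      invFun := fun w => (WithLp.toLp 2 fun i => (w i).re, WithLp.toLp 2 fun i => (w i).im)
      left_inv := fun z => rfl
      right_inv := fun w => rfl
      map_add' := fun z w => rfl
      map_smul' := fun r z => by
        ext i
        refine Complex.ext ?_ ?_ <;> simp }

theorem prodEquivComplex_stdComplex (n : ℕ) (z : Rn n × Rn n) :
    prodEquivComplex n (stdComplex n z) = Complex.I • prodEquivComplex n z := by
  ext i
  change (⟨-z.2 i, z.1 i⟩ : ℂ) = Complex.I * ⟨z.1 i, z.2 i⟩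
  refine Complex.ext ?_ ?_ <;> simp

/-! ### The Kähler structure of the tangent bundle -/

section Kaehler

variable {n : ℕ} {M : Type*} [TopologicalSpace M] [ChartedSpace (Rn n) M]
  [HasGroupoid M (affineGroupoid n)]

theorem dFlatCoord_trivializationAt_symm {p₀ p : TanB n M}
    (hp : p.proj ∈ (chartAt (Rn n) p₀.proj).source) (z : Rn n × Rn n) :
    dFlatCoord (chartAt (Rn n) p₀.proj) p ((trivializationAt (Rn n × Rn n)
      (TangentSpace 𝓘(ℝ, Rn n).tangent : TanB n M → Type _) p₀).symm p z) = z := by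
  rw [← mfderiv_extChartAt_eq_dFlatCoord hp]
  exact mfderiv_extChartAt_trivializationAt_symm
    ((TangentBundle.mem_chart_source_iff p p₀).2 hp) z

/-- In every preferred chart the coefficients of `I` are the constant `stdComplex n`. -/
theorem contMDiff_affineComplex :
    ContMDiff 𝓘(ℝ, Rn n).tangent (𝓘(ℝ, Rn n).tangent.prod 𝓘(ℝ, (Rn n × Rn n) →L[ℝ] Rn n × Rn n)) ∞
      (fun p : TanB n M => TotalSpace.mk' ((Rn n × Rn n) →L[ℝ] Rn n × Rn n)
        (E := fun p : TanB n M =>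
          TangentSpace 𝓘(ℝ, Rn n).tangent p →L[ℝ] TangentSpace 𝓘(ℝ, Rn n).tangent p)
        p (affineComplex n M p)) := by
  intro p₀
  rw [contMDiffAt_hom_bundle]
  refine ⟨contMDiffAt_id, ?_⟩
  refine (contMDiffAt_const (c := stdComplex n)).congr_of_eventuallyEq ?_
  filter_upwards [(tendsto_proj p₀).eventually
    ((chartAt (Rn n) p₀.proj).open_source.mem_nhds (mem_chart_source _ p₀.proj))] with p hp
  have hp' : p ∈ (chartAt (ModelProd (Rn n) (Rn n)) p₀).source :=
    (TangentBundle.mem_chart_source_iff p p₀).2 hp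
  refine ContinuousLinearMap.ext fun z => ?_
  change (trivializationAt (Rn n × Rn n) (TangentSpace 𝓘(ℝ, Rn n).tangent : TanB n M → Type _)
      p₀).continuousLinearMapAt ℝ p (affineComplex n M p ((trivializationAt (Rn n × Rn n)
        (TangentSpace 𝓘(ℝ, Rn n).tangent : TanB n M → Type _) p₀).symmL ℝ p z)) = _
  rw [Trivialization.symmL_apply _ hp', TangentBundle.continuousLinearMapAt_trivializationAt hp',
    mfderiv_extChartAt_eq_dFlatCoord hp, dFlatCoord_affineComplex (isFlatAt_chartAt hp),
    dFlatCoord_trivializationAt_symm hp]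

theorem affineComplex_integrable (p₀ : TanB n M) :
    ∃ (k : ℕ) (Φ : OpenPartialHomeomorph (TanB n M) (EuclideanSpace ℂ (Fin k))),
      p₀ ∈ Φ.source ∧
      ContMDiffOn 𝓘(ℝ, Rn n).tangent 𝓘(ℝ, EuclideanSpace ℂ (Fin k)) ∞ Φ Φ.source ∧
      ContMDiffOn 𝓘(ℝ, EuclideanSpace ℂ (Fin k)) 𝓘(ℝ, Rn n).tangent ∞ Φ.symm Φ.target ∧
      ∀ p ∈ Φ.source, ∀ X : TangentSpace 𝓘(ℝ, Rn n).tangent p,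
        mfderiv 𝓘(ℝ, Rn n).tangent 𝓘(ℝ, EuclideanSpace ℂ (Fin k)) Φ p (affineComplex n M p X) =
          Complex.I • (show EuclideanSpace ℂ (Fin k) from
            mfderiv 𝓘(ℝ, Rn n).tangent 𝓘(ℝ, EuclideanSpace ℂ (Fin k)) Φ p X) := by
  let c := chartAt (ModelProd (Rn n) (Rn n)) p₀
  let E := prodEquivComplex n
  let Φ : OpenPartialHomeomorph (TanB n M) (EuclideanSpace ℂ (Fin n)) :=
    c.transHomeomorph E.toHomeomorph
  have hΦ : (Φ : TanB n M → EuclideanSpace ℂ (Fin n)) =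
    E ∘ extChartAt 𝓘(ℝ, Rn n).tangent p₀ := rfl
  have hΦ' : (Φ.symm : EuclideanSpace ℂ (Fin n) → TanB n M) =
    (extChartAt 𝓘(ℝ, Rn n).tangent p₀).symm ∘ E.symm := rfl
  have hmd : ∀ p ∈ c.source, ContMDiffAt 𝓘(ℝ, Rn n).tangent 𝓘(ℝ, Rn n × Rn n) ∞
      (extChartAt 𝓘(ℝ, Rn n).tangent p₀) p := fun p hp => contMDiffAt_extChartAt' hp
  refine ⟨n, Φ, mem_chart_source (ModelProd (Rn n) (Rn n)) p₀, fun p hp => ?_, ?_, fun p hp X => ?_⟩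
  · rw [hΦ]
    exact (E.contDiff.contMDiff.contMDiffAt.comp p (hmd p hp)).contMDiffWithinAt
  · rw [hΦ']
    refine (contMDiffOn_extChartAt_symm p₀).comp E.symm.contDiff.contMDiff.contMDiffOn ?_
    intro w hw
    rw [extChartAt_target]
    exact ⟨hw, by rw [ModelWithCorners.range_eq_univ]; trivial⟩
  · have hp' : p.proj ∈ (chartAt (Rn n) p₀.proj).source :=
      (TangentBundle.mem_chart_source_iff p p₀).1 hp
    have h := mfderiv_comp p (I'' := 𝓘(ℝ, EuclideanSpace ℂ (Fin n)))
      (E.hasFDerivAt (x := extChartAt 𝓘(ℝ, Rn n).tangent p₀ p)).hasMFDerivAt.mdifferentiableAt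
      ((hmd p hp).mdifferentiableAt (by simp))
    rw [E.hasFDerivAt.hasMFDerivAt.mfderiv, mfderiv_extChartAt_eq_dFlatCoord hp', ← hΦ] at h
    rw [h]
    change E (dFlatCoord _ p (affineComplex n M p X)) = Complex.I • E (dFlatCoord _ p X)
    rw [dFlatCoord_affineComplex (isFlatAt_chartAt hp')]
    exact prodEquivComplex_stdComplex n _

/-- The r-map metric, read in the coordinates induced by a preferred flat chart. -/
theorem rMetric_eq (g : RMetric n M) {x₀ : M} {p : TanB n M}
    (hp : p.proj ∈ (chartAt (Rn n) x₀).source) (X Y : TangentSpace 𝓘(ℝ, Rn n).tangent p) :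
    rMetric g p X Y =
      bilinInChart g.inner x₀ p.proj (dFlatCoord (chartAt (Rn n) x₀) p X).1
        (dFlatCoord (chartAt (Rn n) x₀) p Y).1 +
      bilinInChart g.inner x₀ p.proj (dFlatCoord (chartAt (Rn n) x₀) p X).2
        (dFlatCoord (chartAt (Rn n) x₀) p Y).2 := by
  have hf := isFlatAt_chartAt hp
  have hkey : ∀ v w : TangentSpace 𝓘(ℝ, Rn n) p.proj, g.inner p.proj v w =
      bilinInChart g.inner x₀ p.proj (mfderiv 𝓘(ℝ, Rn n) 𝓘(ℝ, Rn n) (chartAt (Rn n) x₀) p.proj v)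
        (mfderiv 𝓘(ℝ, Rn n) 𝓘(ℝ, Rn n) (chartAt (Rn n) x₀) p.proj w) := fun v w =>
    (bilinInChart_mfderiv g.inner hp v w).symm
  rw [rMetric, hkey, hkey, mfderiv_dProj hf, mfderiv_dProj hf, mfderiv_dProj_affineComplex hf,
    mfderiv_dProj_affineComplex hf]
  simp

/-- The r-map metric as a field of continuous bilinear forms. -/
def rMetricForm (g : RMetric n M) (p : TanB n M) :
    TangentSpace 𝓘(ℝ, Rn n).tangent p →L[ℝ] TangentSpace 𝓘(ℝ, Rn n).tangent p →L[ℝ] ℝ :=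
  let B : Rn n →L[ℝ] Rn n →L[ℝ] ℝ := g.inner p.proj
  let P : Rn n × Rn n →L[ℝ] Rn n := dProj p
  let Q : Rn n × Rn n →L[ℝ] Rn n := dProj p ∘L affineComplex n M p
  B.bilinearComp P P + B.bilinearComp Q Q

theorem rMetricForm_apply (g : RMetric n M) (p : TanB n M)
    (X Y : TangentSpace 𝓘(ℝ, Rn n).tangent p) : rMetricForm g p X Y = rMetric g p X Y := rfl

/-- If both nonnegative summands vanish, then so do `dπ X` and `dπ (I X)`, which up to sign are the
two coordinate components of `X`. -/
theorem rMetric_pos (g : RMetric n M) (p : TanB n M) (X : TangentSpace 𝓘(ℝ, Rn n).tangent p)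
    (hX : X ≠ 0) : 0 < rMetric g p X X := by
  have hnn : ∀ v : TangentSpace 𝓘(ℝ, Rn n) p.proj, 0 ≤ g.inner p.proj v v := fun v => by
    by_cases hv : v = 0
    · simp [hv]
    · exact (g.pos _ v hv).le
  by_contra! h
  have hz : ∀ v : TangentSpace 𝓘(ℝ, Rn n) p.proj, g.inner p.proj v v ≤ 0 → v = 0 := fun v hv => by
    by_contra hne
    exact absurd (g.pos _ v hne) hv.not_gt
  rw [rMetric] at h
  have h1 := hz (dProj p X) (by linarith [hnn (dProj p (affineComplex n M p X))])
  have h2 := hz (dProj p (affineComplex n M p X)) (by linarith [hnn (dProj p X)])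
  have hf := isFlatAt_chartAt (mem_chart_source (Rn n) p.proj)
  refine hX (dFlatCoord_injective hf ?_)
  rw [map_zero]
  refine Prod.ext ?_ (neg_eq_zero.1 ?_)
  · rw [← mfderiv_dProj hf, h1, map_zero]
    rfl
  · rw [← mfderiv_dProj_affineComplex hf, h2, map_zero]
    rfl

/-- The r-map metric as a smooth Riemannian metric. -/
def rRiemannianMetric (g : RMetric n M) :
    ContMDiffRiemannianMetric 𝓘(ℝ, Rn n).tangent ∞ (Rn n × Rn n)
      (TangentSpace 𝓘(ℝ, Rn n).tangent : TanB n M → Type _) where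
  inner := rMetricForm g
  symm p X Y := by
    rw [rMetricForm_apply, rMetricForm_apply, rMetric, rMetric, g.symm, g.symm p.proj (dProj p (affineComplex n M p X))]
  pos p X hX := rMetric_pos g p X hX
  isVonNBounded p := isVonNBounded_of_posDef (F := Rn n × Rn n) (rMetricForm g p)
    (rMetric_pos g p)
  contMDiff p₀ := by
    refine contMDiffAt_bilin_iff.2 ?_
    have hG := contMDiffAt_bilin_iff.1 (g.contMDiff p₀.proj)
    have h := ((contDiff_doubleForm (E := Rn n)).contMDiff.contMDiffAt.comp p₀.proj hG).comp p₀
      (contMDiff_proj (TangentSpace 𝓘(ℝ, Rn n) : M → Type _) p₀)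
    refine h.congr_of_eventuallyEq ?_
    filter_upwards [(tendsto_proj p₀).eventually
      ((chartAt (Rn n) p₀.proj).open_source.mem_nhds (mem_chart_source _ p₀.proj))] with p hp
    have hp' : p ∈ (chartAt (ModelProd (Rn n) (Rn n)) p₀).source :=
      (TangentBundle.mem_chart_source_iff p p₀).2 hp
    refine ContinuousLinearMap.ext fun z => ContinuousLinearMap.ext fun w => ?_
    rw [bilinInChart_apply _ hp', rMetricForm_apply, rMetric_eq g hp,
      dFlatCoord_trivializationAt_symm hp, dFlatCoord_trivializationAt_symm hp]
    rfl

end Kaehler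

/-! ### The Hessian condition and closedness of the Kähler form -/

/-- The third derivative of a smooth function is totally symmetric. -/
theorem third_fderiv_symm {E : Type*} [NormedAddCommGroup E] [NormedSpace ℝ E] {φ : E → ℝ} {x : E}
    (h : ContDiffAt ℝ ∞ φ x) :
    (∀ u v w, fderiv ℝ (fderiv ℝ (fderiv ℝ φ)) x u v w =
      fderiv ℝ (fderiv ℝ (fderiv ℝ φ)) x v u w) ∧
    (∀ u v w, fderiv ℝ (fderiv ℝ (fderiv ℝ φ)) x u v w =
      fderiv ℝ (fderiv ℝ (fderiv ℝ φ)) x u w v) := by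
  have h1 : ContDiffAt ℝ ∞ (fderiv ℝ φ) x := h.fderiv_right (by simp)
  have h2 : ContDiffAt ℝ ∞ (fderiv ℝ (fderiv ℝ φ)) x := h1.fderiv_right (by simp)
  have hmin : minSmoothness ℝ 2 ≤ (∞ : WithTop ℕ∞) := by
    rw [minSmoothness_of_isRCLikeNormedField]
    exact WithTop.coe_le_coe.2 le_top
  refine ⟨fun u v w => ?_, fun u v w => ?_⟩
  · exact congrArg (fun L : E →L[ℝ] ℝ => L w) (h1.isSymmSndFDerivAt hmin u v)
  -- Symmetry in the last two slots comes from differentiating the Schwarz identity for `φ`, which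
  -- holds on a neighbourhood of `x`.
  · have hd := (h2.differentiableAt (by simp)).hasFDerivAt
    have hvw : ∀ a b : E, HasFDerivAt (fun y => fderiv ℝ (fderiv ℝ φ) y a b)
        (((fderiv ℝ (fderiv ℝ (fderiv ℝ φ)) x).flip a).flip b) x := fun a b => by
      simpa using (hd.clm_apply (hasFDerivAt_const a x)).clm_apply (hasFDerivAt_const b x)
    have hsymm : (fun y => fderiv ℝ (fderiv ℝ φ) y v w) =ᶠ[𝓝 x]
        fun y => fderiv ℝ (fderiv ℝ φ) y w v := by
      have h3 : ContDiffAt ℝ 2 φ x := h.of_le (WithTop.coe_le_coe.2 le_top)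
      filter_upwards [h3.eventually (by simp)] with y hy
      exact hy.isSymmSndFDerivAt (by rw [minSmoothness_of_isRCLikeNormedField]) v w
    exact congrArg (fun L : E →L[ℝ] ℝ => L u)
      ((hvw v w).unique ((hvw w v).congr_of_eventuallyEq hsymm))

section Closed

variable {n : ℕ} {M : Type*} [TopologicalSpace M] [ChartedSpace (Rn n) M]
  [HasGroupoid M (affineGroupoid n)]

/-- The derivatives of the components of a Hessian metric in a preferred flat chart are totally
symmetric. -/
theorem IsHessian.exists_symmetric_derivative {g : RMetric n M} (hg : IsHessian g) {x₀ : M}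
    {u₀ : Rn n} (hu₀ : u₀ ∈ (chartAt (Rn n) x₀).target) :
    ∃ S : Rn n → Rn n → Rn n → ℝ, (∀ u v w, S u v w = S v u w) ∧ (∀ u v w, S u v w = S u w v) ∧
      ∀ a b, ∃ L : Rn n →L[ℝ] ℝ, (∀ v, L v = S v a b) ∧
        HasFDerivAt (fun u => bilinInChart g.inner x₀ ((chartAt (Rn n) x₀).symm u) a b) L u₀ := by
  set c := chartAt (Rn n) x₀ with hc
  obtain ⟨e, he, hxe, φ, hφ, hgφ⟩ := hg (c.symm u₀)
  have hxc : c.symm u₀ ∈ c.source := c.map_target hu₀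
  obtain ⟨A, hA⟩ := flatCharts_affineRelatedAt (chartAt_mem_flatCharts x₀) he hxc hxe
  have hsymm : Tendsto c.symm (𝓝 u₀) (𝓝 (c.symm u₀)) := c.continuousAt_symm hu₀
  -- The potential is given in some other flat chart `e = A ∘ c`. Since `A` is affine, the metric in
  -- the chart `c` is again a second derivative of `φ`, evaluated along `A.linear`.
  have hev : ∀ a b, (fun u => bilinInChart g.inner x₀ (c.symm u) a b) =ᶠ[𝓝 u₀]
      fun u => fderiv ℝ (fderiv ℝ φ) (A u) (A.linear a) (A.linear b) := by
    intro a b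
    filter_upwards [hsymm.eventually hA.eventually_nhds, c.open_target.mem_nhds hu₀,
      hsymm.eventually (e.open_source.mem_nhds hxe)]
      with u (h1 : ∀ᶠ y in 𝓝 (c.symm u), e y = (A ∘ c) y) h2 h3
    have hyc : c.symm u ∈ c.source := c.map_target h2
    have hde : ∀ v : Rn n, mfderiv 𝓘(ℝ, Rn n) 𝓘(ℝ, Rn n) e (c.symm u)
        ((trivializationAt (Rn n) (TangentSpace 𝓘(ℝ, Rn n) : M → Type _) x₀).symm (c.symm u) v) =
          A.linear v := fun v => by
      rw [(isFlatAt_chartAt hyc).mfderiv_of_eventuallyEq h1]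
      exact congrArg A.linear
        (mfderiv_extChartAt_trivializationAt_symm (I := 𝓘(ℝ, Rn n)) hyc v)
    rw [bilinInChart_apply _ hyc, hgφ _ h3, hde, hde, h1.self_of_nhds, Function.comp_apply,
      c.right_inv h2]
  have hAu : A u₀ = e (c.symm u₀) := by
    rw [hA.eq_of_nhds, Function.comp_apply, c.right_inv hu₀]
  have hφ' : ContDiffAt ℝ ∞ φ (A u₀) := by
    rw [hAu]
    exact hφ.contDiffAt (e.open_target.mem_nhds (e.map_source hxe))
  obtain ⟨hs1, hs2⟩ := third_fderiv_symm hφ'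
  have h2 : ContDiffAt ℝ ∞ (fderiv ℝ (fderiv ℝ φ)) (A u₀) :=
    (hφ'.fderiv_right (m := ∞) (by simp)).fderiv_right (by simp)
  have hd := (h2.differentiableAt (by simp)).hasFDerivAt.comp u₀ (A.hasFDerivAt u₀)
  refine ⟨fun u v w => fderiv ℝ (fderiv ℝ (fderiv ℝ φ)) (A u₀) (A.linear u) (A.linear v)
    (A.linear w), fun u v w => hs1 _ _ _, fun u v w => hs2 _ _ _, fun a b => ?_⟩
  refine ⟨_, fun v => ?_, HasFDerivAt.congr_of_eventuallyEq
    ((hd.clm_apply (hasFDerivAt_const (A.linear a) u₀)).clm_apply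
      (hasFDerivAt_const (A.linear b) u₀)) (hev a b)⟩
  simp

theorem formInChart_rMetric (g : RMetric n M) (p₀ : TanB n M) {y : Rn n × Rn n}
    (hy : y ∈ (extChartAt 𝓘(ℝ, Rn n).tangent p₀).target) (b c : Rn n × Rn n) :
    formInChart 𝓘(ℝ, Rn n).tangent (affineComplex n M) (rMetric g) p₀ y b c =
      bilinInChart g.inner p₀.proj ((chartAt (Rn n) p₀.proj).symm y.1) b.1 c.2 -
        bilinInChart g.inner p₀.proj ((chartAt (Rn n) p₀.proj).symm y.1) b.2 c.1 := by
  have hq : ((extChartAt 𝓘(ℝ, Rn n).tangent p₀).symm y).proj ∈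
      (chartAt (Rn n) p₀.proj).source :=
    mem_extChartAt_tangent_source.1 ((extChartAt 𝓘(ℝ, Rn n).tangent p₀).map_target hy)
  have hK : ∀ v : Rn n × Rn n, dFlatCoord (chartAt (Rn n) p₀.proj)
      ((extChartAt 𝓘(ℝ, Rn n).tangent p₀).symm y) (mfderiv 𝓘(ℝ, Rn n × Rn n) 𝓘(ℝ, Rn n).tangent
        (extChartAt 𝓘(ℝ, Rn n).tangent p₀).symm y v) = v := fun v => by
    rw [← mfderiv_extChartAt_eq_dFlatCoord hq]
    exact mfderiv_extChartAt_comp_mfderiv_symm hy v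
  have hproj : ((extChartAt 𝓘(ℝ, Rn n).tangent p₀).symm y).proj =
    (chartAt (Rn n) p₀.proj).symm y.1 := rfl
  rw [formInChart, rMetric_eq g hq, dFlatCoord_affineComplex (isFlatAt_chartAt hq), hK, hK,
    stdComplex_apply, hproj]
  simp only [map_neg, neg_apply]
  ring

theorem IsHessian.closed {g : RMetric n M} (hg : IsHessian g) (p₀ : TanB n M) {y : Rn n × Rn n}
    (hy : y ∈ (extChartAt 𝓘(ℝ, Rn n).tangent p₀).target) (a b c : Rn n × Rn n) :
    fderiv ℝ (fun z => formInChart 𝓘(ℝ, Rn n).tangent (affineComplex n M) (rMetric g) p₀ z b c) y a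
      - fderiv ℝ (fun z =>
          formInChart 𝓘(ℝ, Rn n).tangent (affineComplex n M) (rMetric g) p₀ z a c) y b
      + fderiv ℝ (fun z =>
          formInChart 𝓘(ℝ, Rn n).tangent (affineComplex n M) (rMetric g) p₀ z a b) y c = 0 := by
  have hy1 : y.1 ∈ (chartAt (Rn n) p₀.proj).target := by
    rw [extChartAt_target] at hy
    exact (TangentBundle.mem_chart_target_iff (I := 𝓘(ℝ, Rn n)) y p₀).1 hy.1
  obtain ⟨S, hS1, hS2, hS⟩ := hg.exists_symmetric_derivative hy1
  have key : ∀ v b c : Rn n × Rn n,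
      fderiv ℝ (fun z => formInChart 𝓘(ℝ, Rn n).tangent (affineComplex n M) (rMetric g) p₀ z b c)
        y v = S v.1 b.1 c.2 - S v.1 b.2 c.1 := by
    intro v b c
    obtain ⟨L, hL, hLd⟩ := hS b.1 c.2
    obtain ⟨L', hL', hLd'⟩ := hS b.2 c.1
    have hfst : HasFDerivAt (Prod.fst : Rn n × Rn n → Rn n) (.fst ℝ _ _) y := hasFDerivAt_fst
    have h := (hLd.comp y hfst).sub (hLd'.comp y hfst)
    have hev : (fun z =>
        formInChart 𝓘(ℝ, Rn n).tangent (affineComplex n M) (rMetric g) p₀ z b c) =ᶠ[𝓝 y] _ :=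
      (eventually_of_mem ((isOpen_extChartAt_target p₀).mem_nhds hy) fun z hz =>
        formInChart_rMetric g p₀ hz b c)
    rw [(h.congr_of_eventuallyEq hev).fderiv, ← hL, ← hL']
    rfl
  rw [key, key, key]
  -- The six terms cancel in three pairs by the total symmetry of `S`, grouped by which of `a`, `b`,
  -- `c` enters through its fibre component.
  linarith [hS1 a.1 b.1 c.2, hS2 a.1 b.2 c.1, hS1 a.1 c.1 b.2, hS2 b.1 a.2 c.1, hS1 b.1 c.1 a.2,
    hS2 c.1 b.1 a.2]

/-- The tangent bundle of a Hessian manifold is Kähler. -/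
theorem IsHessian.isKahler {g : RMetric n M} (hg : IsHessian g) :
    IsKahler 𝓘(ℝ, Rn n).tangent (affineComplex n M) (rMetric g) where
  smooth_J := contMDiff_affineComplex
  sq_J := affineComplex_sq
  integrable := affineComplex_integrable
  riemannian := ⟨rRiemannianMetric g, fun _ _ _ => rfl⟩
  hermitian p X Y := by
    rw [rMetric, affineComplex_sq, affineComplex_sq, rMetric, map_neg, map_neg, map_neg, map_neg,
      neg_apply, neg_neg, add_comm]
  closed p₀ y hy a b c := hg.closed p₀ hy a b c

end Closed

end

theorem theorem3p2 (n : ℕ) (M : Type*) [TopologicalSpace M] [T2Space M]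
    [SecondCountableTopology M] [SimplyConnectedSpace M] [ChartedSpace (Rn n) M]
    [HasGroupoid M (affineGroupoid n)] (g : RMetric n M) (hg : IsHessian g) :
    -- `I` is standard in the coordinates induced by any flat chart, and `(I, gʳ)` is Kähler
    (∀ e ∈ flatCharts n M, ∀ p : TanB n M, p.proj ∈ e.source →
      ∀ X : TangentSpace 𝓘(ℝ, Rn n).tangent p,
        dTangentCoord e p (affineComplex n M p X) = stdComplex n (dTangentCoord e p X)) ∧
    IsKahler 𝓘(ℝ, Rn n).tangent (affineComplex n M) (rMetric g) ∧
    -- a developing map exists; for each one there is exactly one affine action `θ`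
    (∃ dev : M → Rn n, IsDevelopingMap dev) ∧
    ∀ dev : M → Rn n, IsDevelopingMap dev →
      (∃ Φ : Diffeomorph 𝓘(ℝ, Rn n).tangent (𝓘(ℝ, Rn n).prod 𝓘(ℝ, Rn n))
        (TanB n M) (M × Rn n) ∞, ∀ p, Φ p = flatTriv dev p) ∧
      (∃! θ : affineIsometryGroup g →* (Rn n ≃ᵃ[ℝ] Rn n), IsDevEquivariant dev θ) ∧
      ∀ θ : affineIsometryGroup g →* (Rn n ≃ᵃ[ℝ] Rn n), IsDevEquivariant dev θ →
        -- `ψ` is an action of `G ⋉_θ ℝⁿ`, given by the expected formula on `M × ℝⁿ`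
        IsGroupAction (psi dev θ) ∧
        (∀ (k : AffSemidirect θ) (p : TanB n M), flatTriv dev (psi dev θ k p) =
          ((k.right : M ≃ₜ M) p.proj,
            θ k.right (flatTriv dev p).2 + Multiplicative.toAdd k.left)) ∧
        -- the Kähler structure is invariant
        IsInvariantUnder 𝓘(ℝ, Rn n).tangent (affineComplex n M) (rMetric g) (psi dev θ) ∧
        -- the homogeneous case
        (IsHomogeneousHessian g →
          IsHomogeneousKahler 𝓘(ℝ, Rn n).tangent (affineComplex n M) (rMetric g)
            (psi dev θ)) := by
  refine ⟨?_, hg.isKahler, exists_isDevelopingMap, fun dev hdev => ?_⟩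
  · intro e he p hp X
    rw [dTangentCoord_eq_dFlatCoord]
    exact dFlatCoord_affineComplex (flatCharts_isFlatAt he hp) X
  · have hf := isDevelopingMap_iff.1 hdev
    refine ⟨⟨flatTrivDiffeomorph hf, fun p => rfl⟩, existsUnique_isDevEquivariant hdev,
      fun θ hθ => ⟨isGroupAction_psi hf, flatTriv_psi hf, isInvariantUnder_psi hf hθ,
        fun hhom => ⟨hg.isKahler, isGroupAction_psi hf, isInvariantUnder_psi hf hθ,
          isTransitive_psi hf hhom.2⟩⟩⟩
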